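/- For each $N\ge 1$ let $\mathbf V=\mathbf V(N)$ be a Haar-distributed random $N\times N$ unitary matrix, let $\mathbf a(N)\in\{1,\dots,M\}^N$ be deterministic with $\frac1N|\{k: a_k(N)=m\}|\to\delta_m$ for every $m$, and let $\mathbf z=\mathbf z(N)\in\mathbb C^N$ have independent components, $z_k\sim\mathcal{CN}(0,P_m)$ when $a_k=m$, where $P_1,\dots,P_M\ge 0$ are fixed and $\overline P=\sum_m\delta_mP_m>0$. Let $Q_{\rm tx}:\mathbb C\to\mathbb C$ be Lipschitz, applied componentwise, and for $U\sim\mathcal{CN}(0,\overline P)$ put $$\alpha_{\rm tx}=\frac1{\overline P}\mathbb E[U^*Q_{\rm tx}(U)],\qquad \tau_{\rm tx}=\frac1{\overline P}\mathbb E|Q_{\rm tx}(U)-\alpha_{\rm tx}U|^2,$$ and suppose $\tau_{\rm tx}>0$. The vector $\mathbf x=Q_{\rm tx}(\mathbf V^{\mathsf H}\mathbf z)$ is sent through the AWGN channel $\mathbf y=\mathbf x+\boldsymbol\xi$, where $\boldsymbol\xi$ has i.i.d. $\mathcal{CN}(0,\sigma^2)$ components with $\sigma^2=0$, and is received without quantization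 as $\widehat{\mathbf z}=\mathbf V\mathbf y$; $\mathbf V,\mathbf z,\boldsymbol\xi$ are independent for each $N$. Let $\nu_m=\delta_m(|\alpha_{\rm tx}|^2P_m/\overline P+\tau_{\rm tx})/(|\alpha_{\rm tx}|^2+\tau_{\rm tx})$ be the induced sub-band energy fractions, $D(\boldsymbol\delta\|\boldsymbol\nu)=\sum_m\delta_m\log(\delta_m/\nu_m)$, and let $R_{\rm lin}=\liminf_{N\to\infty}\frac1N I(\mathbf z;\widehat{\mathbf z})\in[0,\infty]$ be the linear rate, in nats. Then $$R_{\rm lin}\ \ge\ \log\Bigl(1+\frac{|\alpha_{\rm tx}|^2}{\tau_{\rm tx}}\Bigr)-D(\boldsymbol\delta\|\boldsymbol\nu),$$ both when $I(\mathbf z;\widehat{\mathbf z})$ is the mutual information under the joint law of $(\mathbf z,\widehat{\mathbf z})$ with $\mathbf V$ random, and, almost surely with respect to the matrices $(\mathbf V(N))_N$, when it is computed for the realized matrices $\mathbf V(N)$ held fixed. The right-hand side equals the zero-noise AWGN bound $\sum_m\delta_m\log\bigl(1+|\alpha_{\rm tx}|^2P_m/(\tau_{\rm tx}\overline P)\bigr)$.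 -/

import Mathlib

open MeasureTheory ProbabilityTheory Filter Topology
open scoped ENNReal NNReal ComplexConjugate Matrix

noncomputable section

/-- The circularly symmetric complex Gaussian law `CN(0, v)` with `E|U|² = v`: independent real and
imaginary parts, each centred Gaussian with variance `v / 2`. For `v = 0` it is the point mass at
zero. -/
def complexGaussian (v : ℝ) : Measure ℂ :=
  ((gaussianReal 0 (v / 2).toNNReal).prod (gaussianReal 0 (v / 2).toNNReal)).map
    Complex.measurableEquivRealProd.symm

/-- The Borel σ-algebra on the group of `N × N` unitary matrices. -/
instance unitaryGroupMeasurableSpace (N : ℕ) :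
    MeasurableSpace (Matrix.unitaryGroup (Fin N) ℂ) := borel _

instance unitaryGroupBorelSpace (N : ℕ) : BorelSpace (Matrix.unitaryGroup (Fin N) ℂ) := ⟨rfl⟩

instance unitaryGroupCompactSpace (N : ℕ) : CompactSpace (Matrix.unitaryGroup (Fin N) ℂ) := by
  have hc : IsCompact (Set.univ.pi fun _ : Fin N => Set.univ.pi fun _ : Fin N =>
      Metric.closedBall (0 : ℂ) 1) :=
    isCompact_univ_pi fun _ => isCompact_univ_pi fun _ => isCompact_closedBall 0 1
  have hcl : IsClosed (Matrix.unitaryGroup (Fin N) ℂ : Set (Matrix (Fin N) (Fin N) ℂ)) :=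
    isClosed_unitary
  have hK : IsCompact (Matrix.unitaryGroup (Fin N) ℂ : Set (Matrix (Fin N) (Fin N) ℂ)) := by
    refine IsCompact.of_isClosed_subset hc hcl ?_
    intro U hU i _ j _
    simpa using entry_norm_bound_of_unitary hU i j
  exact isCompact_iff_compactSpace.mp hK

/-- The uniform (Haar) probability measure on the group of `N × N` unitary matrices. -/
def haarUnitary (N : ℕ) : Measure (Matrix.unitaryGroup (Fin N) ℂ) :=
  Measure.haarMeasure ⊤

/-- Mutual information `I(X; Y)` (in nats) of two random variables: the Kullback-Leibler divergence
of the joint law from the product of the marginal laws, with values in `[0, ∞]`. -/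
def mutualInfo {Ω α β : Type*} [MeasurableSpace Ω] [MeasurableSpace α] [MeasurableSpace β]
    (μ : Measure Ω) (X : Ω → α) (Y : Ω → β) : ℝ≥0∞ :=
  InformationTheory.klDiv (μ.map fun ω => (X ω, Y ω)) ((μ.map X).prod (μ.map Y))

/-- The received frequency-domain vector
`ẑ = V Q_rx(F(Q_tx(Vᴴ z), ξ))`, where the DAC `Qtx`, the channel `F` and the ADC `Qrx` act
componentwise. -/
def receivedSymbols {N : ℕ} (Qtx : ℂ → ℂ) (F : ℂ → ℂ → ℂ) (Qrx : ℂ → ℂ)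
    (V : Matrix.unitaryGroup (Fin N) ℂ) (z ξ : Fin N → ℂ) : Fin N → ℂ :=
  (V : Matrix (Fin N) (Fin N) ℂ) *ᵥ
    fun n => Qrx (F (Qtx (((V : Matrix (Fin N) (Fin N) ℂ)ᴴ *ᵥ z) n)) (ξ n))

/-- The linear gain `α_tx = E[U* Q(U)] / P̄` of the DAC, `U ~ CN(0, P̄)`. -/
def alphaTx (Q : ℂ → ℂ) (Pbar : ℝ) : ℂ :=
  (∫ u, conj u * Q u ∂(complexGaussian Pbar)) / (Pbar : ℂ)

/-- The normalized distortion `τ_tx = E|Q(U) - α_tx U|² / P̄` of the DAC, `U ~ CN(0, P̄)`. -/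
def tauTx (Q : ℂ → ℂ) (Pbar : ℝ) : ℝ :=
  (∫ u, ‖Q u - alphaTx Q Pbar * u‖ ^ 2 ∂(complexGaussian Pbar)) / Pbar

/-- The induced sub-band energy fractions
`ν_m = δ_m (|α|² P_m / P̄ + τ) / (|α|² + τ)`. -/
def energyFraction {M : ℕ} (δ P : Fin M → ℝ) (Pbar : ℝ) (α : ℂ) (τ : ℝ) (m : Fin M) : ℝ :=
  δ m * (‖α‖ ^ 2 * P m / Pbar + τ) / (‖α‖ ^ 2 + τ)

/-- The divergence `D(p‖q) = ∑ p_m log (p_m / q_m)` of two finite probability vectors, with terms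
at `p_m = 0` equal to zero. It is used for vectors with `q_m > 0` whenever `p_m > 0`. -/
def vecDivergence {M : ℕ} (p q : Fin M → ℝ) : ℝ :=
  ∑ m, p m * Real.log (p m / q m)

/-- The rate `liminf (1 / N) I_N` of a sequence of mutual informations. -/
def asymptoticRate (I : ℕ → ℝ≥0∞) : ℝ≥0∞ :=
  liminf (fun N : ℕ => I N / (N : ℝ≥0∞)) atTop

end

/-! For random transforms the bound is mismatched decoding. By `ofReal_integral_le_klDiv`, a
divergence is at least the mean of any test function whose exponential has mean one under the second
measure. The test function T is the log-likelihood ratio of the Gaussian channel y = αz + w with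
noise variance s = τP̄ per component. By Bayes' rule exp T integrates to 1 over the Gaussian input
for each fixed y, whatever the true output law is. Hence I ≥ E T, and it remains to show E T ≥ ∑
log(1 + |α|²P_k/s) - o(N).

The output is αz + D with D = V d(Vᴴz) and d(u) = Q(u) - αu, and T = -‖D‖²/s + ∑ c_k |αz_k + D_k|² +
∑ log(1 + |α|²P_k/s) with c_k = 1/(|α|²P_k + s). For Haar V the vector Vᴴz is white Gaussian noise
rescaled to the length of z (`map_haarUnitary_mulVec`). So ‖D‖² is close to Ns, while the inner
product of z and D is o(N), because d(U) is uncorrelated with U (`exists_distortion_bounds`).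
Unitaries fixing z preserve the law of D, so its part orthogonal to z is isotropic and uncorrelated
with its part along z. The energy of D is therefore spread evenly over the coordinates
(`integral_weighted_energy_ge`), E|αz_k + D_k|² is about |α|²P_k + s, and the first two terms of E T
cancel to leading order.

For fixed transforms the absence of noise makes the output a function of the input. Finite mutual
information would force almost all its values into a countable set, which a Lipschitz Q permits only
if it is constant (`mutualInfo_conjTransform_eq_top`). So for nonconstant Q the mutual information
is eventually infinite; for constant Q, α = 0 and the bound is zero. -/

/-- The Donsker-Varadhan lower bound for the Kullback-Leibler divergence. -/
lemma ofReal_integral_le_klDiv {α : Type*} [MeasurableSpace α] (μ ν : Measure α)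
    [IsProbabilityMeasure μ] [IsProbabilityMeasure ν] {f : α → ℝ} (hfμ : Integrable f μ)
    (hfν : Integrable (fun x => Real.exp (f x)) ν) (h1 : ∫ x, Real.exp (f x) ∂ν = 1) :
    ENNReal.ofReal (∫ x, f x ∂μ) ≤ InformationTheory.klDiv μ ν := by
  by_cases hac : μ ≪ ν
  swap
  · simp [InformationTheory.klDiv_of_not_ac hac]
  by_cases hint : Integrable (llr μ ν) μ
  swap
  · simp [InformationTheory.klDiv_of_not_integrable hint]
  rw [InformationTheory.klDiv_of_ac_of_integrable hac hint]
  apply ENNReal.ofReal_le_ofReal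
  -- Nonnegativity of the divergence of μ from ν tilted by f is the claim: this divergence is that
  -- from ν, minus the mean of f, plus the logarithm of ∫ exp f, which is zero.
  have := isProbabilityMeasure_tilted hfν
  have hac' : μ ≪ ν.tilted f := hac.trans (absolutelyContinuous_tilted hfν)
  have hint' := integrable_llr_tilted_right hac hfμ hint hfν
  have h0 := InformationTheory.integral_llr_add_sub_measure_univ_nonneg hac' hint'
  rw [integral_llr_tilted_right hac hfμ hfν hint, h1] at h0
  simp only [probReal_univ, Real.log_one] at h0 ⊢
  linarith

/-! ### Gaussian integrals of exponentials of quadratics -/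

/-- Completing the square. A multiple of another Gaussian density appears, so integrability and the
value of the integral both follow from its normalization. -/
lemma exp_quadratic_mul_gaussianPDFReal {v : ℝ≥0} (hv : v ≠ 0) {κ : ℝ} (hκ : 0 ≤ κ) (t x : ℝ) :
    gaussianPDFReal 0 v x * Real.exp (t * x - κ * x ^ 2) =
      (Real.sqrt (1 + 2 * κ * v))⁻¹ * Real.exp (t ^ 2 * v / (2 * (1 + 2 * κ * v))) *
        gaussianPDFReal (t * v / (1 + 2 * κ * v)) (v / (1 + 2 * κ * v).toNNReal) x := by
  have hv' : (0 : ℝ) < v := by positivity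
  have hD : 0 < 1 + 2 * κ * v := by positivity
  simp only [gaussianPDFReal, NNReal.coe_div, Real.coe_toNNReal _ hD.le]
  rw [show 2 * Real.pi * ((v : ℝ) / (1 + 2 * κ * v)) = (2 * Real.pi * v) / (1 + 2 * κ * v) by ring,
    Real.sqrt_div' _ hD.le]
  have hs : Real.sqrt (1 + 2 * κ * v) ≠ 0 := by positivity
  have hs' : Real.sqrt (2 * Real.pi * v) ≠ 0 := by positivity
  rw [mul_assoc, ← Real.exp_add]
  rw [show ∀ a b c d : ℝ, a * b * (c * Real.exp d) = a * c * (b * Real.exp d) by intros; ring,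
    ← Real.exp_add]
  congr 1
  · field_simp
  · congr 1
    field_simp
    ring

lemma integrable_exp_quadratic_gaussianReal (v : ℝ≥0) {κ : ℝ} (hκ : 0 ≤ κ) (t : ℝ) :
    Integrable (fun x => Real.exp (t * x - κ * x ^ 2)) (gaussianReal 0 v) := by
  by_cases hv : v = 0
  · subst hv
    rw [gaussianReal_zero_var]
    exact integrable_dirac (by simp)
  rw [gaussianReal_of_var_ne_zero _ hv]
  have hm : Measurable (gaussianPDF 0 v) := measurable_gaussianPDF 0 v
  rw [integrable_withDensity_iff hm (ae_of_all _ fun _ => gaussianPDF_lt_top)]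
  have : (fun x => Real.exp (t * x - κ * x ^ 2) * (gaussianPDF 0 v x).toReal) = fun x =>
      (Real.sqrt (1 + 2 * κ * v))⁻¹ * Real.exp (t ^ 2 * v / (2 * (1 + 2 * κ * v))) *
        gaussianPDFReal (t * v / (1 + 2 * κ * v)) (v / (1 + 2 * κ * v).toNNReal) x := by
    ext x
    rw [toReal_gaussianPDF, mul_comm, exp_quadratic_mul_gaussianPDFReal hv hκ]
  rw [this]
  exact (integrable_gaussianPDFReal _ _).const_mul _

lemma integral_exp_quadratic_gaussianReal (v : ℝ≥0) {κ : ℝ} (hκ : 0 ≤ κ) (t : ℝ) :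
    ∫ x, Real.exp (t * x - κ * x ^ 2) ∂(gaussianReal 0 v) =
      (Real.sqrt (1 + 2 * κ * v))⁻¹ * Real.exp (t ^ 2 * v / (2 * (1 + 2 * κ * v))) := by
  by_cases hv : v = 0
  · subst hv
    simp [gaussianReal_zero_var]
  rw [integral_gaussianReal_eq_integral_smul hv]
  simp_rw [smul_eq_mul, exp_quadratic_mul_gaussianPDFReal hv hκ]
  have hD : 0 < 1 + 2 * κ * v := by positivity
  rw [integral_const_mul, integral_gaussianPDFReal_eq_one, mul_one]
  have : (1 + 2 * κ * v).toNNReal ≠ 0 := by simpa using hD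
  positivity

/-! ### Moments and transforms of the complex Gaussian law -/

instance isProbabilityMeasure_complexGaussian (v : ℝ) :
    IsProbabilityMeasure (complexGaussian v) :=
  Measure.isProbabilityMeasure_map (by fun_prop)

lemma measurePreserving_complexGaussian (v : ℝ) :
    MeasurePreserving Complex.measurableEquivRealProd.symm
      ((gaussianReal 0 (v / 2).toNNReal).prod (gaussianReal 0 (v / 2).toNNReal))
      (complexGaussian v) :=
  ⟨by fun_prop, rfl⟩

lemma integral_complexGaussian {E : Type*} [NormedAddCommGroup E] [NormedSpace ℝ E] (v : ℝ)
    (f : ℂ → E) :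
    ∫ u, f u ∂(complexGaussian v) = ∫ p : ℝ × ℝ, f ⟨p.1, p.2⟩
      ∂((gaussianReal 0 (v / 2).toNNReal).prod (gaussianReal 0 (v / 2).toNNReal)) :=
  ((measurePreserving_complexGaussian v).integral_comp' f).symm

lemma integrable_complexGaussian_iff {E : Type*} [NormedAddCommGroup E] (v : ℝ)
    (f : ℂ → E) :
    Integrable f (complexGaussian v) ↔ Integrable (fun p : ℝ × ℝ => f ⟨p.1, p.2⟩)
      ((gaussianReal 0 (v / 2).toNNReal).prod (gaussianReal 0 (v / 2).toNNReal)) :=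
  ((measurePreserving_complexGaussian v).integrable_comp_emb
    Complex.measurableEquivRealProd.symm.measurableEmbedding).symm

lemma memLp_id_complexGaussian (v : ℝ) (p : ℝ≥0) :
    MemLp (fun u : ℂ => u) p (complexGaussian v) := by
  have hre : MemLp (fun u : ℂ => u.re) p (complexGaussian v) := by
    rw [← (measurePreserving_complexGaussian v).map_eq,
      memLp_map_measure_iff (by fun_prop) (by fun_prop)]
    exact (memLp_id_gaussianReal p).comp_measurePreserving measurePreserving_fst
  have him : MemLp (fun u : ℂ => u.im) p (complexGaussian v) := by
    rw [← (measurePreserving_complexGaussian v).map_eq,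
      memLp_map_measure_iff (by fun_prop) (by fun_prop)]
    exact (memLp_id_gaussianReal p).comp_measurePreserving measurePreserving_snd
  refine (hre.norm.add him.norm).of_le (by fun_prop) (ae_of_all _ fun u => ?_)
  refine (Complex.norm_le_abs_re_add_abs_im u).trans ?_
  simp only [Pi.add_apply, Real.norm_eq_abs]
  exact le_abs_self _

lemma integrable_norm_pow_complexGaussian (v : ℝ) (p : ℕ) :
    Integrable (fun u : ℂ => ‖u‖ ^ p) (complexGaussian v) := by
  have := (memLp_id_complexGaussian v p).integrable_norm_pow'
  simpa using this

lemma integral_norm_sq_complexGaussian {v : ℝ} (hv : 0 ≤ v) :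
    ∫ u, ‖u‖ ^ 2 ∂(complexGaussian v) = v := by
  rw [integral_complexGaussian]
  have h1 : ∀ p : ℝ × ℝ, ‖(⟨p.1, p.2⟩ : ℂ)‖ ^ 2 = p.1 ^ 2 + p.2 ^ 2 := fun p => by
    rw [Complex.sq_norm, Complex.normSq_mk]; ring
  simp_rw [h1]
  have h2 : ∀ w : ℝ≥0, Integrable (fun x : ℝ => x ^ 2) (gaussianReal 0 w) := fun w => by
    simpa using (memLp_id_gaussianReal (μ := 0) (v := w) 2).integrable_sq
  have h3 : ∀ w : ℝ≥0, ∫ x, x ^ 2 ∂(gaussianReal 0 w) = w := fun w => by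
    have := variance_fun_id_gaussianReal (μ := 0) (v := w)
    rw [variance_eq_integral (by fun_prop)] at this
    simpa [integral_id_gaussianReal] using this
  rw [integral_add ((h2 _).comp_fst _) ((h2 _).comp_snd _),
    integral_fun_fst (fun x : ℝ => x ^ 2), integral_fun_snd (fun x : ℝ => x ^ 2)]
  simp only [h3, probReal_univ, one_smul]
  rw [Real.coe_toNNReal _ (by positivity)]
  ring

lemma charFunDual_complexGaussian {v : ℝ} (hv : 0 ≤ v) (L : StrongDual ℝ ℂ) :
    charFunDual (complexGaussian v) L =
      Complex.exp (-((L 1 ^ 2 + L Complex.I ^ 2) * (v / 4) : ℝ)) := by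
  rw [charFunDual_apply, integral_complexGaussian]
  have h1 : ∀ p : ℝ × ℝ, L ⟨p.1, p.2⟩ = p.1 * L 1 + p.2 * L Complex.I := fun p => by
    have : (⟨p.1, p.2⟩ : ℂ) = p.1 • (1 : ℂ) + p.2 • Complex.I := by
      apply Complex.ext <;> simp
    rw [this, map_add, map_smul, map_smul, smul_eq_mul, smul_eq_mul]
  simp_rw [h1]
  have h2 : ∀ p : ℝ × ℝ, Complex.exp ((p.1 * L 1 + p.2 * L Complex.I : ℝ) * Complex.I) =
      Complex.exp (L 1 * p.1 * Complex.I) * Complex.exp (L Complex.I * p.2 * Complex.I) := by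
    intro p
    rw [← Complex.exp_add]
    congr 1
    push_cast
    ring
  simp_rw [h2]
  rw [integral_prod_mul (fun x : ℝ => Complex.exp (L 1 * x * Complex.I))
    (fun x : ℝ => Complex.exp (L Complex.I * x * Complex.I)), ← charFun_apply_real,
    ← charFun_apply_real, charFun_gaussianReal, charFun_gaussianReal, ← Complex.exp_add]
  congr 1
  rw [Real.coe_toNNReal _ (by positivity)]
  push_cast
  ring

lemma exp_complex_quadratic_eq (κ : ℝ) (c : ℂ) (p : ℝ × ℝ) :
    Real.exp (2 * (conj c * ⟨p.1, p.2⟩).re - κ * ‖(⟨p.1, p.2⟩ : ℂ)‖ ^ 2) =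
      Real.exp (2 * c.re * p.1 - κ * p.1 ^ 2) * Real.exp (2 * c.im * p.2 - κ * p.2 ^ 2) := by
  rw [← Real.exp_add, Complex.sq_norm, Complex.normSq_mk]
  congr 1
  simp
  ring

lemma integrable_exp_quadratic_complexGaussian (v : ℝ) {κ : ℝ} (hκ : 0 ≤ κ) (c : ℂ) :
    Integrable (fun u : ℂ => Real.exp (2 * (conj c * u).re - κ * ‖u‖ ^ 2)) (complexGaussian v) := by
  rw [integrable_complexGaussian_iff]
  simp_rw [exp_complex_quadratic_eq]
  exact (integrable_exp_quadratic_gaussianReal _ hκ _).mul_prod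
    (integrable_exp_quadratic_gaussianReal _ hκ _)

/-- The real and imaginary parts each contribute an inverse square root; their product is the
rational prefactor. -/
lemma integral_exp_quadratic_complexGaussian {v : ℝ} (hv : 0 ≤ v) {κ : ℝ} (hκ : 0 ≤ κ) (c : ℂ) :
    ∫ u, Real.exp (2 * (conj c * u).re - κ * ‖u‖ ^ 2) ∂(complexGaussian v) =
      (1 + κ * v)⁻¹ * Real.exp (‖c‖ ^ 2 * v / (1 + κ * v)) := by
  rw [integral_complexGaussian]
  simp_rw [exp_complex_quadratic_eq]
  rw [integral_prod_mul (fun x : ℝ => Real.exp (2 * c.re * x - κ * x ^ 2))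
    (fun x : ℝ => Real.exp (2 * c.im * x - κ * x ^ 2)), integral_exp_quadratic_gaussianReal _ hκ,
    integral_exp_quadratic_gaussianReal _ hκ]
  rw [Real.coe_toNNReal _ (by positivity), show 1 + 2 * κ * (v / 2) = 1 + κ * v by ring]
  have hD : 0 < 1 + κ * v := by positivity
  rw [show ∀ a b c : ℝ, a * b * (a * c) = (a * a) * (b * c) by intros; ring, ← Real.exp_add,
    ← mul_inv, Real.mul_self_sqrt hD.le, Complex.sq_norm, Complex.normSq_apply]
  congr 2
  field_simp

/-! ### Hermitian geometry and unitary reflections -/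

/-- The squared Euclidean norm of a complex vector. -/
noncomputable def sqNorm {N : ℕ} (v : Fin N → ℂ) : ℝ := ∑ k, ‖v k‖ ^ 2

lemma sqNorm_nonneg {N : ℕ} (v : Fin N → ℂ) : 0 ≤ sqNorm v :=
  Finset.sum_nonneg fun _ _ => by positivity

lemma continuous_sqNorm {N : ℕ} : Continuous (sqNorm : (Fin N → ℂ) → ℝ) := by
  unfold sqNorm
  fun_prop

lemma star_dotProduct_self {N : ℕ} (v : Fin N → ℂ) : star v ⬝ᵥ v = (sqNorm v : ℂ) := by
  simp [dotProduct, sqNorm, Complex.conj_mul']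

lemma sqNorm_eq_re {N : ℕ} (v : Fin N → ℂ) : sqNorm v = (star v ⬝ᵥ v).re := by
  rw [star_dotProduct_self, Complex.ofReal_re]

lemma sqNorm_eq_zero {N : ℕ} {v : Fin N → ℂ} : sqNorm v = 0 ↔ v = 0 := by
  unfold sqNorm
  rw [Finset.sum_eq_zero_iff_of_nonneg (fun _ _ => by positivity)]
  simp [funext_iff]

lemma sqNorm_smul {N : ℕ} (c : ℂ) (v : Fin N → ℂ) : sqNorm (c • v) = ‖c‖ ^ 2 * sqNorm v := by
  simp [sqNorm, Finset.mul_sum, mul_pow]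

lemma sqNorm_eq_norm_sq {N : ℕ} (v : Fin N → ℂ) : sqNorm v = ‖WithLp.toLp 2 v‖ ^ 2 := by
  rw [EuclideanSpace.norm_sq_eq]
  rfl

lemma star_dotProduct_mulVec {N : ℕ} (A : Matrix (Fin N) (Fin N) ℂ) (p q : Fin N → ℂ) :
    star p ⬝ᵥ (A *ᵥ q) = star (Aᴴ *ᵥ p) ⬝ᵥ q := by
  rw [Matrix.star_mulVec, Matrix.conjTranspose_conjTranspose, Matrix.dotProduct_mulVec]

lemma conjTranspose_mulVec_mulVec {N : ℕ} (U : Matrix.unitaryGroup (Fin N) ℂ) (p : Fin N → ℂ) :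
    (U : Matrix (Fin N) (Fin N) ℂ)ᴴ *ᵥ ((U : Matrix (Fin N) (Fin N) ℂ) *ᵥ p) = p := by
  have := Matrix.mem_unitaryGroup_iff'.mp U.2
  rw [Matrix.star_eq_conjTranspose] at this
  rw [Matrix.mulVec_mulVec, this, Matrix.one_mulVec]

lemma mulVec_conjTranspose_mulVec {N : ℕ} (U : Matrix.unitaryGroup (Fin N) ℂ) (p : Fin N → ℂ) :
    (U : Matrix (Fin N) (Fin N) ℂ) *ᵥ ((U : Matrix (Fin N) (Fin N) ℂ)ᴴ *ᵥ p) = p := by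
  have := Matrix.mem_unitaryGroup_iff.mp U.2
  rw [Matrix.star_eq_conjTranspose] at this
  rw [Matrix.mulVec_mulVec, this, Matrix.one_mulVec]

lemma star_mulVec_dotProduct_mulVec {N : ℕ} (U : Matrix.unitaryGroup (Fin N) ℂ)
    (p q : Fin N → ℂ) :
    star ((U : Matrix (Fin N) (Fin N) ℂ) *ᵥ p) ⬝ᵥ ((U : Matrix (Fin N) (Fin N) ℂ) *ᵥ q) =
      star p ⬝ᵥ q := by
  rw [star_dotProduct_mulVec, conjTranspose_mulVec_mulVec]

lemma sqNorm_unitary_mulVec {N : ℕ} (U : Matrix.unitaryGroup (Fin N) ℂ) (p : Fin N → ℂ) :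
    sqNorm ((U : Matrix (Fin N) (Fin N) ℂ) *ᵥ p) = sqNorm p := by
  rw [sqNorm_eq_re, star_mulVec_dotProduct_mulVec, ← sqNorm_eq_re]

lemma sqNorm_unitary_conjTranspose_mulVec {N : ℕ} (U : Matrix.unitaryGroup (Fin N) ℂ)
    (p : Fin N → ℂ) : sqNorm ((U : Matrix (Fin N) (Fin N) ℂ)ᴴ *ᵥ p) = sqNorm p := by
  conv_rhs => rw [← mulVec_conjTranspose_mulVec U p]
  rw [sqNorm_unitary_mulVec]

/-- Two vectors of equal norm are related by a unitary matrix that fixes their common orthogonal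
complement. -/
lemma exists_unitary_mulVec_eq {N : ℕ} {p q : Fin N → ℂ} (hpq : sqNorm p = sqNorm q) :
    ∃ U : Matrix.unitaryGroup (Fin N) ℂ, (U : Matrix (Fin N) (Fin N) ℂ) *ᵥ p = q ∧
      ∀ x, star p ⬝ᵥ x = 0 → star q ⬝ᵥ x = 0 → (U : Matrix (Fin N) (Fin N) ℂ) *ᵥ x = x := by
  by_cases hne : p = q
  · exact ⟨1, by simp [hne], fun x _ _ => by simp⟩
  set r := p - q with hr
  set a := star r ⬝ᵥ p with ha
  -- Equality of the norms gives 2 Re a = ‖r‖², which is exactly what makes 1 - a⁻¹ r r* unitary.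
  -- The complex factor a⁻¹ replaces the Householder factor 2/‖r‖², which would send p to q only if
  -- a were real.
  have hsum : a + conj a = star r ⬝ᵥ r := by
    have h1 : conj a = star p ⬝ᵥ r := by
      rw [ha, starRingEnd_apply, ← Matrix.star_dotProduct_star, star_star, dotProduct_comm]
    rw [h1, ha, hr]
    simp only [star_sub, sub_dotProduct, dotProduct_sub, star_dotProduct_self, hpq]
    ring
  have ha0 : a ≠ 0 := by
    intro h0
    rw [h0, map_zero, add_zero, star_dotProduct_self, eq_comm, Complex.ofReal_eq_zero,
      sqNorm_eq_zero] at hsum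
    exact hne (sub_eq_zero.mp hsum)
  have hca0 : conj a ≠ 0 := by simpa using ha0
  set W : Matrix (Fin N) (Fin N) ℂ := 1 - a⁻¹ • Matrix.vecMulVec r (star r) with hW
  have hWx : ∀ x, W *ᵥ x = x - (a⁻¹ * (star r ⬝ᵥ x)) • r := by
    intro x
    rw [hW, Matrix.sub_mulVec, Matrix.one_mulVec, Matrix.smul_mulVec, Matrix.vecMulVec_mulVec]
    ext i
    simp
    ring
  have hWu : W ∈ Matrix.unitaryGroup (Fin N) ℂ := by
    rw [Matrix.mem_unitaryGroup_iff, Matrix.star_eq_conjTranspose, hW]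
    have h2 : (Matrix.vecMulVec r (star r))ᴴ = Matrix.vecMulVec r (star r) := by
      rw [Matrix.conjTranspose_vecMulVec, star_star]
    rw [Matrix.conjTranspose_sub, Matrix.conjTranspose_smul, h2, Matrix.conjTranspose_one,
      sub_mul, one_mul, mul_sub, mul_one, smul_mul_smul_comm, Matrix.vecMulVec_mul_vecMulVec,
      ← hsum]
    ext i j
    simp [Matrix.vecMulVec_apply]
    field_simp
    ring
  refine ⟨⟨W, hWu⟩, ?_, ?_⟩
  · change W *ᵥ p = q
    rw [hWx, ← ha, inv_mul_cancel₀ ha0, one_smul, hr, sub_sub_cancel]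
  · intro x hp hq
    change W *ᵥ x = x
    rw [hWx, hr, star_sub, sub_dotProduct, hp, hq]
    simp

/-! ### Haar measure, unitary invariance of white noise, and rotated vectors -/

instance isProbabilityMeasure_haarUnitary (N : ℕ) : IsProbabilityMeasure (haarUnitary N) :=
  ⟨Measure.haarMeasure_self⟩

instance isMulLeftInvariant_haarUnitary (N : ℕ) : (haarUnitary N).IsMulLeftInvariant :=
  inferInstanceAs (Measure.haarMeasure ⊤).IsMulLeftInvariant

lemma integrable_haarUnitary {E : Type*} [NormedAddCommGroup E] {N : ℕ}
    [SecondCountableTopology E]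
    {f : Matrix.unitaryGroup (Fin N) ℂ → E} (hf : Continuous f) :
    Integrable f (haarUnitary N) := by
  rw [← integrableOn_univ]
  exact hf.continuousOn.integrableOn_compact isCompact_univ

@[fun_prop]
lemma continuous_coe_unitaryGroup {N : ℕ} :
    Continuous fun V : Matrix.unitaryGroup (Fin N) ℂ => (V : Matrix (Fin N) (Fin N) ℂ) :=
  continuous_subtype_val

instance secondCountableTopology_unitaryGroup (N : ℕ) :
    SecondCountableTopology (Matrix.unitaryGroup (Fin N) ℂ) := by
  have : SecondCountableTopology (Matrix (Fin N) (Fin N) ℂ) :=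
    inferInstanceAs (SecondCountableTopology (Fin N → Fin N → ℂ))
  exact Topology.IsEmbedding.subtypeVal.secondCountableTopology

/-- The transform depends on the functional only through the norm of its representing vector; this
is the source of unitary invariance. -/
lemma charFunDual_pi_complexGaussian {N : ℕ} {v : ℝ} (hv : 0 ≤ v)
    (L : StrongDual ℝ (Fin N → ℂ)) (t : Fin N → ℂ) (hL : ∀ x, L x = (star t ⬝ᵥ x).re) :
    charFunDual (Measure.pi fun _ : Fin N => complexGaussian v) L =
      Complex.exp (-(sqNorm t * (v / 4) : ℝ)) := by
  rw [charFunDual_pi]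
  simp_rw [charFunDual_complexGaussian hv]
  rw [← Complex.exp_sum]
  congr 1
  rw [← Complex.ofReal_neg, sqNorm, Finset.sum_mul, ← Finset.sum_neg_distrib, Complex.ofReal_sum]
  push_cast
  refine Finset.sum_congr rfl fun k _ => ?_
  have h1 : (L ∘ (ContinuousLinearMap.single ℝ (fun _ => ℂ) k)) 1 = (t k).re := by
    simp [hL]
  have h2 : (L ∘ (ContinuousLinearMap.single ℝ (fun _ => ℂ) k)) Complex.I = (t k).im := by
    simp [hL]
  rw [h1, h2, ← Complex.ofReal_pow ‖t k‖, Complex.sq_norm, Complex.normSq_apply]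
  push_cast
  ring

/-- The white complex Gaussian law is invariant under unitary transforms. -/
lemma map_unitary_pi_complexGaussian {N : ℕ} {v : ℝ} (hv : 0 ≤ v)
    (U : Matrix.unitaryGroup (Fin N) ℂ) :
    (Measure.pi fun _ : Fin N => complexGaussian v).map
      (fun x => (U : Matrix (Fin N) (Fin N) ℂ) *ᵥ x) =
        Measure.pi fun _ : Fin N => complexGaussian v := by
  set A : (Fin N → ℂ) →L[ℝ] (Fin N → ℂ) :=
    ((Matrix.mulVecLin (U : Matrix (Fin N) (Fin N) ℂ)).restrictScalars ℝ).toContinuousLinearMap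
    with hA
  have hAx : ∀ x, A x = (U : Matrix (Fin N) (Fin N) ℂ) *ᵥ x := fun x => by simp [hA]
  have hAf : (fun x => (U : Matrix (Fin N) (Fin N) ℂ) *ᵥ x) = A := by
    ext1 x
    rw [hAx]
  rw [hAf]
  have : IsFiniteMeasure
      ((Measure.pi fun _ : Fin N => complexGaussian v).map A) := by infer_instance
  refine Measure.ext_of_charFunDual ?_
  ext1 L
  rw [charFunDual_map]
  set t : Fin N → ℂ := fun k => ⟨L (Pi.single k 1), L (Pi.single k Complex.I)⟩ with ht
  have hL : ∀ x, L x = (star t ⬝ᵥ x).re := by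
    intro x
    have hx : x = ∑ k, ((x k).re • (Pi.single k (1 : ℂ) : Fin N → ℂ) +
        (x k).im • (Pi.single k Complex.I : Fin N → ℂ)) := by
      ext1 j
      simp only [Finset.sum_apply, Pi.add_apply, Pi.smul_apply]
      rw [Finset.sum_eq_single j]
      · apply Complex.ext <;> simp
      · intro b _ hb
        simp [hb.symm]
      · simp
    conv_lhs => rw [hx]
    simp only [map_sum, map_add, map_smul, smul_eq_mul, dotProduct, Complex.re_sum]
    refine Finset.sum_congr rfl fun k _ => ?_
    simp [ht]
    ring
  rw [charFunDual_pi_complexGaussian hv L t hL,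
    charFunDual_pi_complexGaussian hv (L.comp A) ((U : Matrix (Fin N) (Fin N) ℂ)ᴴ *ᵥ t),
    sqNorm_unitary_conjTranspose_mulVec]
  intro x
  rw [ContinuousLinearMap.comp_apply, hAx, hL, star_dotProduct_mulVec]

lemma volume_absolutelyContinuous_complexGaussian {v : ℝ} (hv : 0 < v) :
    (volume : Measure ℂ) ≪ complexGaussian v := by
  have hv' : (v / 2).toNNReal ≠ 0 := by simpa using hv
  have h1 := Complex.volume_preserving_equiv_real_prod.symm.map_eq
  rw [complexGaussian, ← h1]
  refine Measure.AbsolutelyContinuous.map ?_ Complex.measurableEquivRealProd.symm.measurable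
  exact (gaussianReal_absolutelyContinuous' 0 hv').prod (gaussianReal_absolutelyContinuous' 0 hv')

lemma complexGaussian_singleton_zero {v : ℝ} (hv : 0 < v) : complexGaussian v {0} = 0 := by
  have hv' : (v / 2).toNNReal ≠ 0 := by simpa using hv
  have := nullSingletonClass_gaussianReal (μ := 0) hv'
  rw [complexGaussian, Measure.map_apply (by fun_prop) (measurableSet_singleton _)]
  refine measure_mono_null (t := {(0 : ℝ)} ×ˢ Set.univ) ?_ ?_
  · intro p hp
    have := congrArg Complex.re (Set.mem_singleton_iff.mp hp)
    simpa using this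
  · rw [Measure.prod_prod, measure_singleton, zero_mul]

lemma ae_pi_complexGaussian_ne_zero {N : ℕ} {P : Fin N → ℝ} {k : Fin N} (hk : 0 < P k) :
    ∀ᵐ z ∂(Measure.pi fun k => complexGaussian (P k)), z ≠ 0 := by
  have h1 : ∀ᵐ u ∂(complexGaussian (P k)), u ≠ 0 := by
    rw [ae_iff]
    simpa using complexGaussian_singleton_zero hk
  have h2 := (measurePreserving_eval (fun k => complexGaussian (P k)) k).quasiMeasurePreserving.ae h1
  filter_upwards [h2] with z hz h0
  exact hz (by simp [h0])

lemma continuous_unitary_conjTranspose_mulVec {N : ℕ} :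
    Continuous fun p : Matrix.unitaryGroup (Fin N) ℂ × (Fin N → ℂ) =>
      (p.1 : Matrix (Fin N) (Fin N) ℂ)ᴴ *ᵥ p.2 :=
  (continuous_coe_unitaryGroup.comp continuous_fst).matrix_conjTranspose.matrix_mulVec
    continuous_snd

lemma continuous_unitary_mulVec {N : ℕ} :
    Continuous fun p : Matrix.unitaryGroup (Fin N) ℂ × (Fin N → ℂ) =>
      (p.1 : Matrix (Fin N) (Fin N) ℂ) *ᵥ p.2 :=
  (continuous_coe_unitaryGroup.comp continuous_fst).matrix_mulVec continuous_snd

/-- The white Gaussian vector `g`, rescaled to have the norm of `z`. -/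
noncomputable def rescaleTo {N : ℕ} (z g : Fin N → ℂ) : Fin N → ℂ :=
  ((√(sqNorm z) / √(sqNorm g) : ℝ) : ℂ) • g

lemma measurable_rescaleTo {N : ℕ} (z : Fin N → ℂ) : Measurable (rescaleTo z) := by
  have h := (continuous_sqNorm (N := N)).measurable
  have h2 : Measurable fun g : Fin N → ℂ => ((√(sqNorm z) / √(sqNorm g) : ℝ) : ℂ) := by
    fun_prop
  exact h2.smul measurable_id

lemma sqNorm_rescaleTo {N : ℕ} (z : Fin N → ℂ) {g : Fin N → ℂ} (hg : g ≠ 0) :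
    sqNorm (rescaleTo z g) = sqNorm z := by
  have hg' : sqNorm g ≠ 0 := fun h => hg (sqNorm_eq_zero.mp h)
  rw [rescaleTo, sqNorm_smul, Complex.norm_real, Real.norm_eq_abs, sq_abs, div_pow,
    Real.sq_sqrt (sqNorm_nonneg _), Real.sq_sqrt (sqNorm_nonneg _), div_mul_cancel₀ _ hg']

/-- A Haar-rotated vector of given norm has the law of a rescaled white Gaussian vector. -/
lemma map_haarUnitary_mulVec {N : ℕ} (hN : 0 < N) {v : ℝ} (hv : 0 < v) (z : Fin N → ℂ) :
    (haarUnitary N).map (fun V : Matrix.unitaryGroup (Fin N) ℂ =>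
        (V : Matrix (Fin N) (Fin N) ℂ)ᴴ *ᵥ z) =
      (Measure.pi fun _ : Fin N => complexGaussian v).map (rescaleTo z) := by
  set γ := Measure.pi fun _ : Fin N => complexGaussian v with hγ
  have hmz : Measurable fun V : Matrix.unitaryGroup (Fin N) ℂ =>
      (V : Matrix (Fin N) (Fin N) ℂ)ᴴ *ᵥ z :=
    (continuous_unitary_conjTranspose_mulVec.comp (Continuous.prodMk_left z)).measurable
  have key : ∀ F : (Fin N → ℂ) → ℝ≥0∞, Measurable F →
      ∫⁻ V, F ((V : Matrix (Fin N) (Fin N) ℂ)ᴴ *ᵥ z) ∂(haarUnitary N) =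
        ∫⁻ g, F (rescaleTo z g) ∂γ := by
    intro F hF
    -- Left translation by a unitary carrying z to z' shows that the Haar average sees z only
    -- through its norm.
    have h1 : ∀ z', sqNorm z' = sqNorm z →
        ∫⁻ V, F ((V : Matrix (Fin N) (Fin N) ℂ)ᴴ *ᵥ z') ∂(haarUnitary N) =
          ∫⁻ V, F ((V : Matrix (Fin N) (Fin N) ℂ)ᴴ *ᵥ z) ∂(haarUnitary N) := by
      intro z' hz'
      obtain ⟨U, hU, -⟩ := exists_unitary_mulVec_eq hz'.symm
      rw [← lintegral_mul_left_eq_self _ U]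
      refine lintegral_congr fun V => ?_
      rw [Submonoid.coe_mul, Matrix.conjTranspose_mul, ← Matrix.mulVec_mulVec, ← hU,
        conjTranspose_mulVec_mulVec]
    -- Since only the norm matters, z may be replaced by the random vector `rescaleTo z g`, which
    -- has the same norm off the null event g = 0. After exchanging the integrals, V is absorbed by
    -- the unitary invariance of g.
    have h2 : ∫⁻ V, F ((V : Matrix (Fin N) (Fin N) ℂ)ᴴ *ᵥ z) ∂(haarUnitary N) =
        ∫⁻ g, ∫⁻ V, F ((V : Matrix (Fin N) (Fin N) ℂ)ᴴ *ᵥ (rescaleTo z g)) ∂(haarUnitary N) ∂γ := by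
      have h : ∀ᵐ g ∂γ,
          ∫⁻ V, F ((V : Matrix (Fin N) (Fin N) ℂ)ᴴ *ᵥ (rescaleTo z g)) ∂(haarUnitary N) =
            ∫⁻ V, F ((V : Matrix (Fin N) (Fin N) ℂ)ᴴ *ᵥ z) ∂(haarUnitary N) := by
        filter_upwards [ae_pi_complexGaussian_ne_zero (P := fun _ : Fin N => v) (k := ⟨0, hN⟩) hv]
          with g hg
        exact h1 _ (sqNorm_rescaleTo z hg)
      rw [lintegral_congr_ae h]
      simp
    rw [h2, lintegral_lintegral_swap]
    · have h3 : ∀ V : Matrix.unitaryGroup (Fin N) ℂ,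
          ∫⁻ g, F ((V : Matrix (Fin N) (Fin N) ℂ)ᴴ *ᵥ (rescaleTo z g)) ∂γ =
            ∫⁻ g, F (rescaleTo z g) ∂γ := by
        intro V
        conv_rhs => rw [hγ, ← map_unitary_pi_complexGaussian hv.le V⁻¹]
        have hm : Measurable fun x => ((V⁻¹ : Matrix.unitaryGroup (Fin N) ℂ) :
            Matrix (Fin N) (Fin N) ℂ) *ᵥ x :=
          (continuous_unitary_mulVec.comp (Continuous.prodMk_right V⁻¹)).measurable
        rw [lintegral_map (f := fun g => F (rescaleTo z g)) (hF.comp (measurable_rescaleTo z)) hm]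
        refine lintegral_congr fun g => ?_
        rw [rescaleTo, rescaleTo, sqNorm_unitary_mulVec, Matrix.mulVec_smul]
        rfl
      simp [h3]
    · have hm : Measurable fun p : (Fin N → ℂ) × Matrix.unitaryGroup (Fin N) ℂ =>
          (p.2, rescaleTo z p.1) :=
        measurable_snd.prodMk ((measurable_rescaleTo z).comp measurable_fst)
      have hm2 := continuous_unitary_conjTranspose_mulVec (N := N) |>.measurable.comp hm
      exact (hF.comp hm2).aemeasurable
  ext s hs
  have := key (s.indicator 1) (measurable_one.indicator hs)
  rw [← lintegral_map (measurable_one.indicator hs) hmz,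
    ← lintegral_map (measurable_one.indicator hs) (measurable_rescaleTo z),
    lintegral_indicator_one hs, lintegral_indicator_one hs] at this
  exact this

lemma integral_haarUnitary_mulVec {N : ℕ} (hN : 0 < N) {v : ℝ} (hv : 0 < v) (z : Fin N → ℂ)
    {F : (Fin N → ℂ) → ℝ} (hF : Continuous F) :
    ∫ V, F ((V : Matrix (Fin N) (Fin N) ℂ)ᴴ *ᵥ z) ∂(haarUnitary N) =
      ∫ g, F (rescaleTo z g) ∂(Measure.pi fun _ : Fin N => complexGaussian v) := by
  have hmz : Measurable fun V : Matrix.unitaryGroup (Fin N) ℂ =>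
      (V : Matrix (Fin N) (Fin N) ℂ)ᴴ *ᵥ z :=
    (continuous_unitary_conjTranspose_mulVec.comp (Continuous.prodMk_left z)).measurable
  rw [← integral_map hmz.aemeasurable hF.aestronglyMeasurable, map_haarUnitary_mulVec hN hv z,
    integral_map (measurable_rescaleTo z).aemeasurable hF.aestronglyMeasurable]

/-! ### Symmetry under the unitaries that fix the input -/

section Stabilizer

variable {N : ℕ} (d : (Fin N → ℂ) → (Fin N → ℂ)) (z : Fin N → ℂ)

/-- The vector `V d(Vᴴ z)`. -/
def conjTransform (V : Matrix.unitaryGroup (Fin N) ℂ) : Fin N → ℂ :=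
  (V : Matrix (Fin N) (Fin N) ℂ) *ᵥ d ((V : Matrix (Fin N) (Fin N) ℂ)ᴴ *ᵥ z)

variable {d z}

lemma continuous_conjTransform (hd : Continuous d) : Continuous (conjTransform d z) :=
  continuous_unitary_mulVec.comp (continuous_id.prodMk
    (hd.comp (continuous_unitary_conjTranspose_mulVec.comp (Continuous.prodMk_left z))))

/-- Replacing V by UV does not change Haar measure, and (UV)ᴴz = Vᴴz when U fixes z. Only the outer
factor keeps the U. -/
lemma integral_conjTransform_stabilizer {E : Type*} [NormedAddCommGroup E] [NormedSpace ℝ E]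
    (f : (Fin N → ℂ) → E) {U : Matrix.unitaryGroup (Fin N) ℂ}
    (hU : (U : Matrix (Fin N) (Fin N) ℂ) *ᵥ z = z) :
    ∫ V, f (conjTransform d z V) ∂(haarUnitary N) =
      ∫ V, f ((U : Matrix (Fin N) (Fin N) ℂ) *ᵥ conjTransform d z V) ∂(haarUnitary N) := by
  rw [← integral_mul_left_eq_self _ U]
  refine integral_congr_ae (ae_of_all _ fun V => ?_)
  simp only [conjTransform, Submonoid.coe_mul, Matrix.conjTranspose_mul]
  rw [← Matrix.mulVec_mulVec, ← Matrix.mulVec_mulVec]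
  congr 5
  conv_lhs => rw [← hU]
  rw [conjTranspose_mulVec_mulVec]

lemma integral_norm_sq_dotProduct_conjTransform_eq {p q : Fin N → ℂ} (hp : star p ⬝ᵥ z = 0)
    (hq : star q ⬝ᵥ z = 0) (hpq : sqNorm p = sqNorm q) :
    ∫ V, ‖star p ⬝ᵥ conjTransform d z V‖ ^ 2 ∂(haarUnitary N) =
      ∫ V, ‖star q ⬝ᵥ conjTransform d z V‖ ^ 2 ∂(haarUnitary N) := by
  obtain ⟨U, hU, hfix⟩ := exists_unitary_mulVec_eq hpq
  rw [integral_conjTransform_stabilizer (fun x => ‖star q ⬝ᵥ x‖ ^ 2) (hfix z hp hq)]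
  refine integral_congr_ae (ae_of_all _ fun V => ?_)
  simp only
  rw [← hU, star_mulVec_dotProduct_mulVec]

/-- Second moments of `V d(Vᴴ z)` orthogonally to `z` are isotropic. -/
lemma sqNorm_mul_integral_norm_sq_dotProduct_conjTransform {p q : Fin N → ℂ}
    (hp : star p ⬝ᵥ z = 0) (hq : star q ⬝ᵥ z = 0) :
    sqNorm q * ∫ V, ‖star p ⬝ᵥ conjTransform d z V‖ ^ 2 ∂(haarUnitary N) =
      sqNorm p * ∫ V, ‖star q ⬝ᵥ conjTransform d z V‖ ^ 2 ∂(haarUnitary N) := by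
  have h : ∀ (c : ℝ) (r : Fin N → ℂ), 0 ≤ c →
      c * ∫ V, ‖star r ⬝ᵥ conjTransform d z V‖ ^ 2 ∂(haarUnitary N) =
        ∫ V, ‖star ((√c : ℂ) • r) ⬝ᵥ conjTransform d z V‖ ^ 2 ∂(haarUnitary N) := by
    intro c r hc
    rw [← integral_const_mul]
    refine integral_congr_ae (ae_of_all _ fun V => ?_)
    simp only [star_smul, smul_dotProduct, smul_eq_mul, norm_mul, mul_pow]
    congr 1
    simp [Real.sq_sqrt hc]
  rw [h _ _ (sqNorm_nonneg q), h _ _ (sqNorm_nonneg p)]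
  refine integral_norm_sq_dotProduct_conjTransform_eq (by simp [hp]) (by simp [hq]) ?_
  rw [sqNorm_smul, sqNorm_smul, Complex.norm_real, Complex.norm_real, Real.norm_eq_abs,
    Real.norm_eq_abs, sq_abs, sq_abs, Real.sq_sqrt (sqNorm_nonneg _),
    Real.sq_sqrt (sqNorm_nonneg _), mul_comm]

/-- A unitary sending p to -p and fixing z preserves the law but flips the sign of the integrand. No
property of f is needed, since its argument is unchanged. -/
lemma integral_cross_conjTransform_eq_zero {p : Fin N → ℂ} (hp : star p ⬝ᵥ z = 0) (f : ℂ → ℂ) :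
    ∫ V, f (star z ⬝ᵥ conjTransform d z V) * (star p ⬝ᵥ conjTransform d z V)
      ∂(haarUnitary N) = 0 := by
  have hpn : sqNorm p = sqNorm (-p) := by simp [sqNorm]
  obtain ⟨U, hU, hfix⟩ := exists_unitary_mulVec_eq hpn
  have hUz := hfix z hp (by simp [hp])
  have hUp : (U : Matrix (Fin N) (Fin N) ℂ) *ᵥ (-p) = p := by rw [Matrix.mulVec_neg, hU, neg_neg]
  have h := integral_conjTransform_stabilizer (d := d)
    (fun x => f (star z ⬝ᵥ x) * (star p ⬝ᵥ x)) hUz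
  have h2 : ∀ x, f (star z ⬝ᵥ ((U : Matrix (Fin N) (Fin N) ℂ) *ᵥ x)) *
      (star p ⬝ᵥ ((U : Matrix (Fin N) (Fin N) ℂ) *ᵥ x)) =
        -(f (star z ⬝ᵥ x) * (star p ⬝ᵥ x)) := by
    intro x
    conv_lhs => rw [← hUp]
    conv_lhs => enter [1, 1]; rw [← hUz]
    rw [star_mulVec_dotProduct_mulVec, star_mulVec_dotProduct_mulVec, star_neg, neg_dotProduct,
      mul_neg]
  simp_rw [h2, integral_neg] at h
  exact self_eq_neg.mp h

end Stabilizer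

/-! ### Energy of the output along and across the input -/

lemma continuous_star_dotProduct {N : ℕ} (p : Fin N → ℂ) :
    Continuous fun x : Fin N → ℂ => star p ⬝ᵥ x := by
  unfold dotProduct
  fun_prop

lemma sqNorm_conjTransform {N : ℕ} (d : (Fin N → ℂ) → (Fin N → ℂ)) (z : Fin N → ℂ)
    (V : Matrix.unitaryGroup (Fin N) ℂ) :
    sqNorm (conjTransform d z V) = sqNorm (d ((V : Matrix (Fin N) (Fin N) ℂ)ᴴ *ᵥ z)) :=
  sqNorm_unitary_mulVec _ _

lemma star_dotProduct_conjTransform {N : ℕ} (d : (Fin N → ℂ) → (Fin N → ℂ)) (z : Fin N → ℂ)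
    (V : Matrix.unitaryGroup (Fin N) ℂ) :
    star z ⬝ᵥ conjTransform d z V = star ((V : Matrix (Fin N) (Fin N) ℂ)ᴴ *ᵥ z) ⬝ᵥ
      d ((V : Matrix (Fin N) (Fin N) ℂ)ᴴ *ᵥ z) :=
  star_dotProduct_mulVec _ _ _

/-- The component of the `k`-th coordinate vector orthogonal to `z`. -/
noncomputable def perpSingle {N : ℕ} (z : Fin N → ℂ) (k : Fin N) : Fin N → ℂ :=
  Pi.single k 1 - (conj (z k) / (sqNorm z : ℂ)) • z

lemma star_perpSingle_dotProduct {N : ℕ} (z : Fin N → ℂ) (k : Fin N) (x : Fin N → ℂ) :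
    star (perpSingle z k) ⬝ᵥ x = x k - z k / (sqNorm z : ℂ) * (star z ⬝ᵥ x) := by
  rw [perpSingle, star_sub, sub_dotProduct, star_smul, smul_dotProduct, smul_eq_mul,
    ← Pi.single_star, single_dotProduct, star_one, one_mul]
  simp

lemma star_perpSingle_dotProduct_self {N : ℕ} {z : Fin N → ℂ} (hz : z ≠ 0) (k : Fin N) :
    star (perpSingle z k) ⬝ᵥ z = 0 := by
  have hS : (sqNorm z : ℂ) ≠ 0 := by
    simpa [sqNorm_eq_zero] using hz
  rw [star_perpSingle_dotProduct, star_dotProduct_self]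
  field_simp
  ring

lemma sqNorm_perpSingle {N : ℕ} {z : Fin N → ℂ} (hz : z ≠ 0) (k : Fin N) :
    sqNorm (perpSingle z k) = 1 - ‖z k‖ ^ 2 / sqNorm z := by
  rw [sqNorm_eq_re]
  conv_lhs => enter [1, 2]; rw [perpSingle]
  rw [dotProduct_sub, dotProduct_smul, star_perpSingle_dotProduct_self hz,
    dotProduct_single, mul_one, smul_zero, sub_zero, perpSingle]
  have h : star (Pi.single k 1 - (conj (z k) / (sqNorm z : ℂ)) • z : Fin N → ℂ) k =
      ((1 - ‖z k‖ ^ 2 / sqNorm z : ℝ) : ℂ) := by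
    simp only [Pi.star_apply, Pi.sub_apply, Pi.single_eq_same, Pi.smul_apply, smul_eq_mul]
    rw [div_mul_eq_mul_div, Complex.conj_mul']
    rw [← Complex.ofReal_pow, ← Complex.ofReal_div, ← Complex.ofReal_one, ← Complex.ofReal_sub]
    exact Complex.conj_ofReal _
  rw [h, Complex.ofReal_re]

/-- The projections of an orthonormal basis onto the complement of z form a Parseval frame there, so
the sum is the energy of x orthogonal to z. -/
lemma sum_norm_sq_star_perpSingle_dotProduct {N : ℕ} {z : Fin N → ℂ} (hz : z ≠ 0)
    (x : Fin N → ℂ) :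
    ∑ k, ‖star (perpSingle z k) ⬝ᵥ x‖ ^ 2 = sqNorm x - ‖star z ⬝ᵥ x‖ ^ 2 / sqNorm z := by
  have hS : sqNorm z ≠ 0 := fun h => hz (sqNorm_eq_zero.mp h)
  set β := star z ⬝ᵥ x with hβ
  have h1 : ∀ k, ‖star (perpSingle z k) ⬝ᵥ x‖ ^ 2 =
      ‖x k‖ ^ 2 - 2 / sqNorm z * (conj β * (conj (z k) * x k)).re +
        ‖β‖ ^ 2 / sqNorm z ^ 2 * ‖z k‖ ^ 2 := by
    intro k
    rw [star_perpSingle_dotProduct, ← hβ, Complex.sq_norm, Complex.normSq_sub, Complex.normSq_mul,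
      Complex.normSq_div, Complex.normSq_ofReal, Complex.sq_norm, Complex.sq_norm, Complex.sq_norm,
      map_mul, map_div₀, Complex.conj_ofReal]
    have : x k * (conj (z k) / (sqNorm z : ℂ) * conj β) =
        ((sqNorm z)⁻¹ : ℝ) * (conj β * (conj (z k) * x k)) := by
      push_cast
      ring
    rw [this, Complex.re_ofReal_mul]
    ring
  simp_rw [h1]
  rw [Finset.sum_add_distrib, Finset.sum_sub_distrib, ← Finset.mul_sum, ← Finset.mul_sum,
    ← Complex.re_sum, ← Finset.mul_sum]
  have h2 : ∑ k, conj (z k) * x k = β := rfl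
  have h3 : ∑ k, ‖z k‖ ^ 2 = sqNorm z := rfl
  have h4 : ∑ k, ‖x k‖ ^ 2 = sqNorm x := rfl
  rw [h2, h3, h4, Complex.conj_mul', ← Complex.ofReal_pow, Complex.ofReal_re]
  field_simp
  ring

/-- Isotropy compares direction k with every direction l; summing over l yields the total orthogonal
energy on one side and, on the other, the dimension N - 1 of the complement as the sum of the
‖`perpSingle z l`‖². -/
lemma integral_norm_sq_perpSingle_dotProduct_conjTransform {N : ℕ}
    {d : (Fin N → ℂ) → (Fin N → ℂ)} (hd : Continuous d) {z : Fin N → ℂ} (hz : z ≠ 0)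
    (k : Fin N) :
    (N - 1 : ℝ) * ∫ V, ‖star (perpSingle z k) ⬝ᵥ conjTransform d z V‖ ^ 2 ∂(haarUnitary N) =
      (1 - ‖z k‖ ^ 2 / sqNorm z) * ∫ V, (sqNorm (conjTransform d z V) -
        ‖star z ⬝ᵥ conjTransform d z V‖ ^ 2 / sqNorm z) ∂(haarUnitary N) := by
  have hS : sqNorm z ≠ 0 := fun h => hz (sqNorm_eq_zero.mp h)
  have h1 : ∀ l, (1 - ‖z l‖ ^ 2 / sqNorm z) *
      ∫ V, ‖star (perpSingle z k) ⬝ᵥ conjTransform d z V‖ ^ 2 ∂(haarUnitary N) =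
      (1 - ‖z k‖ ^ 2 / sqNorm z) *
      ∫ V, ‖star (perpSingle z l) ⬝ᵥ conjTransform d z V‖ ^ 2 ∂(haarUnitary N) := by
    intro l
    rw [← sqNorm_perpSingle hz, ← sqNorm_perpSingle hz]
    exact sqNorm_mul_integral_norm_sq_dotProduct_conjTransform
      (star_perpSingle_dotProduct_self hz k) (star_perpSingle_dotProduct_self hz l)
  have h2 := Finset.sum_congr rfl fun l (_ : l ∈ Finset.univ) => h1 l
  rw [← Finset.sum_mul, ← Finset.mul_sum, ← integral_finsetSum] at h2
  · simp_rw [sum_norm_sq_star_perpSingle_dotProduct hz] at h2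
    rw [← h2]
    congr 1
    rw [Finset.sum_sub_distrib, ← Finset.sum_div]
    change _ = _ - sqNorm z / sqNorm z
    rw [div_self hS]
    simp
  · intro l _
    exact integrable_haarUnitary
      (((continuous_star_dotProduct _).comp (continuous_conjTransform hd)).norm.pow 2)

lemma norm_add_sq_ge (a b : ℂ) : ‖a‖ ^ 2 - 2 * ‖a‖ * ‖b‖ ≤ ‖a + b‖ ^ 2 := by
  have h := norm_sub_norm_le a (-b)
  have h' := norm_sub_norm_le (-b) a
  rw [norm_neg] at h h'
  rw [sub_neg_eq_add] at h
  rw [show -b - a = -(a + b) by ring, norm_neg] at h'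
  have h3 : (‖a‖ - ‖b‖) ^ 2 ≤ ‖a + b‖ ^ 2 := sq_le_sq' (by linarith) h
  nlinarith [sq_nonneg ‖b‖]

/-- Lower bound for the weighted energy of `α z + V d(Vᴴ z)`, `V` Haar-distributed. -/
theorem integral_weighted_energy_ge {N : ℕ} (hN : 2 ≤ N)
    {d : (Fin N → ℂ) → (Fin N → ℂ)} (hd : Continuous d) {z : Fin N → ℂ} (hz : z ≠ 0)
    {c : Fin N → ℝ} {C : ℝ} (hc : ∀ k, 0 ≤ c k) (hcC : ∀ k, c k ≤ C) (α : ℂ) :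
    ‖α‖ ^ 2 * ∑ k, c k * ‖z k‖ ^ 2
      - 2 * ‖α‖ * C * ∫ V, ‖star z ⬝ᵥ conjTransform d z V‖ ∂(haarUnitary N)
      + (∑ k, c k - C) / (N - 1) * ∫ V, (sqNorm (conjTransform d z V) -
        ‖star z ⬝ᵥ conjTransform d z V‖ ^ 2 / sqNorm z) ∂(haarUnitary N)
      ≤ ∫ V, ∑ k, c k * ‖α * z k + conjTransform d z V k‖ ^ 2 ∂(haarUnitary N) := by
  have hS : 0 < sqNorm z := lt_of_le_of_ne (sqNorm_nonneg z)
    fun h => hz (sqNorm_eq_zero.mp h.symm)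
  have hSC : (sqNorm z : ℂ) ≠ 0 := by exact_mod_cast hS.ne'
  have hN1 : (0 : ℝ) < N - 1 := by
    have : (2 : ℝ) ≤ N := by exact_mod_cast hN
    linarith
  have hDc := continuous_conjTransform (z := z) hd
  have hβc : Continuous fun V => star z ⬝ᵥ conjTransform d z V :=
    (continuous_star_dotProduct _).comp hDc
  have hDk : ∀ k, Continuous fun V => conjTransform d z V k :=
    fun k => (continuous_apply k).comp hDc
  set B := ∫ V, ‖star z ⬝ᵥ conjTransform d z V‖ ∂(haarUnitary N) with hB
  set Λ := ∫ V, (sqNorm (conjTransform d z V) -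
        ‖star z ⬝ᵥ conjTransform d z V‖ ^ 2 / sqNorm z) ∂(haarUnitary N) with hΛ
  have hB0 : 0 ≤ B := integral_nonneg fun V => norm_nonneg _
  have hΛ0 : 0 ≤ Λ := integral_nonneg fun V => by
    change 0 ≤ _
    rw [← sum_norm_sq_star_perpSingle_dotProduct hz]
    positivity
  have hk : ∀ k, ‖z k‖ ^ 2 * (‖α‖ ^ 2 - 2 * ‖α‖ * B / sqNorm z) +
      (1 - ‖z k‖ ^ 2 / sqNorm z) * Λ / (N - 1) ≤
        ∫ V, ‖α * z k + conjTransform d z V k‖ ^ 2 ∂(haarUnitary N) := by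
    intro k
    have hpc : Continuous fun V => star (perpSingle z k) ⬝ᵥ conjTransform d z V :=
      (continuous_star_dotProduct _).comp hDc
    -- Coordinate k splits as (α + β/‖z‖²) z_k plus the orthogonal part y. The mixed term has mean
    -- zero, and |α + β/‖z‖²|² is bounded below by dropping |β|²/‖z‖⁴.
    have hpt : ∀ V, ‖z k‖ ^ 2 * (‖α‖ ^ 2 - 2 * ‖α‖ / sqNorm z *
        ‖star z ⬝ᵥ conjTransform d z V‖) + ‖star (perpSingle z k) ⬝ᵥ conjTransform d z V‖ ^ 2 +
        2 * ((fun t => conj ((α + t / (sqNorm z : ℂ)) * z k)) (star z ⬝ᵥ conjTransform d z V) *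
          (star (perpSingle z k) ⬝ᵥ conjTransform d z V)).re ≤
        ‖α * z k + conjTransform d z V k‖ ^ 2 := by
      intro V
      set β := star z ⬝ᵥ conjTransform d z V with hβ
      set y := star (perpSingle z k) ⬝ᵥ conjTransform d z V with hy
      have h1 : α * z k + conjTransform d z V k = (α + β / (sqNorm z : ℂ)) * z k + y := by
        rw [hy, star_perpSingle_dotProduct]
        ring
      rw [h1, add_comm _ y, Complex.sq_norm (y + _), Complex.normSq_add, ← Complex.sq_norm,
        ← Complex.sq_norm, norm_mul, mul_pow]
      have h2 := norm_add_sq_ge α (β / (sqNorm z : ℂ))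
      rw [norm_div, Complex.norm_real, Real.norm_eq_abs, abs_of_pos hS] at h2
      have h3 := mul_le_mul_of_nonneg_left h2 (sq_nonneg ‖z k‖)
      simp only
      rw [mul_comm (conj _) y]
      have h4 : 2 * ‖α‖ / sqNorm z * ‖β‖ = 2 * ‖α‖ * (‖β‖ / sqNorm z) := by ring
      rw [h4]
      linarith
    have hi1 : Integrable (fun V => ‖z k‖ ^ 2 * (‖α‖ ^ 2 - 2 * ‖α‖ / sqNorm z *
        ‖star z ⬝ᵥ conjTransform d z V‖)) (haarUnitary N) :=
      integrable_haarUnitary (by fun_prop)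
    have hi2 : Integrable (fun V => ‖star (perpSingle z k) ⬝ᵥ conjTransform d z V‖ ^ 2)
        (haarUnitary N) := integrable_haarUnitary (by fun_prop)
    have hcr : Continuous (fun V =>
        ((fun t => conj ((α + t / (sqNorm z : ℂ)) * z k)) (star z ⬝ᵥ conjTransform d z V) *
          (star (perpSingle z k) ⬝ᵥ conjTransform d z V))) := by
      have : Continuous fun t : ℂ => conj ((α + t / (sqNorm z : ℂ)) * z k) :=
        Complex.continuous_conj.comp (by fun_prop)
      exact (this.comp hβc).mul hpc
    have hi3 := integrable_haarUnitary hcr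
    have hle := integral_mono ((hi1.add hi2).add (hi3.re.const_mul 2))
      (integrable_haarUnitary (f := fun V => ‖α * z k + conjTransform d z V k‖ ^ 2)
        (by have := hDk k; fun_prop)) hpt
    refine le_trans (le_of_eq ?_) hle
    have hcross := integral_cross_conjTransform_eq_zero (d := d)
      (star_perpSingle_dotProduct_self hz k)
      (fun t => conj ((α + t / (sqNorm z : ℂ)) * z k))
    have e1 := integral_add (hi1.add hi2) (hi3.re.const_mul 2)
    have e2 := integral_add hi1 hi2
    have e3 : ∫ V, RCLike.re (((fun t => conj ((α + t / (sqNorm z : ℂ)) * z k))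
        (star z ⬝ᵥ conjTransform d z V) *
          (star (perpSingle z k) ⬝ᵥ conjTransform d z V))) ∂(haarUnitary N) = 0 := by
      rw [integral_re hi3, hcross, map_zero]
    have e4 : ∫ V, ‖z k‖ ^ 2 * (‖α‖ ^ 2 - 2 * ‖α‖ / sqNorm z *
        ‖star z ⬝ᵥ conjTransform d z V‖) ∂(haarUnitary N) =
          ‖z k‖ ^ 2 * (‖α‖ ^ 2 - 2 * ‖α‖ / sqNorm z * B) := by
      rw [integral_const_mul, integral_sub (integrable_const _)
        (integrable_haarUnitary (by fun_prop)), integral_const_mul]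
      simp [hB]
    have e5 := integral_norm_sq_perpSingle_dotProduct_conjTransform hd hz k
    rw [← hΛ] at e5
    refine Eq.trans ?_ e1.symm
    refine Eq.trans ?_ (congrArg₂ (· + ·) e2.symm (integral_const_mul 2 _).symm)
    rw [e4]
    refine Eq.trans ?_ (congrArg (fun t => _ + 2 * t) e3.symm)
    rw [mul_zero, add_zero, ← e5]
    field_simp
  rw [integral_finsetSum _ fun k _ => integrable_haarUnitary (by have := hDk k; fun_prop)]
  simp_rw [integral_const_mul]
  refine le_trans ?_ (Finset.sum_le_sum fun k _ => mul_le_mul_of_nonneg_left (hk k) (hc k))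
  have hsum : ∑ k, c k * (‖z k‖ ^ 2 * (‖α‖ ^ 2 - 2 * ‖α‖ * B / sqNorm z) +
      (1 - ‖z k‖ ^ 2 / sqNorm z) * Λ / (N - 1)) =
      (∑ k, c k * ‖z k‖ ^ 2) * (‖α‖ ^ 2 - 2 * ‖α‖ * B / sqNorm z) +
        (∑ k, c k - (∑ k, c k * ‖z k‖ ^ 2) / sqNorm z) * (Λ / (N - 1)) := by
    rw [Finset.sum_mul, Finset.sum_div, ← Finset.sum_sub_distrib, Finset.sum_mul,
      ← Finset.sum_add_distrib]
    refine Finset.sum_congr rfl fun k _ => ?_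
    ring
  rw [hsum]
  -- The |z_k|²-weighted average of the c_k is at most C. This bounds the loss along z and accounts
  -- for the -C beside the sum of the c_k.
  have hA : (∑ k, c k * ‖z k‖ ^ 2) / sqNorm z ≤ C := by
    rw [div_le_iff₀ hS, sqNorm, Finset.mul_sum]
    exact Finset.sum_le_sum fun k _ => mul_le_mul_of_nonneg_right (hcC k) (by positivity)
  have h1 := mul_le_mul_of_nonneg_right hA (by positivity : 0 ≤ 2 * ‖α‖ * B)
  have h2 := mul_le_mul_of_nonneg_right hA (by positivity : 0 ≤ Λ / (N - 1))
  have h3 : (∑ k, c k * ‖z k‖ ^ 2) * (‖α‖ ^ 2 - 2 * ‖α‖ * B / sqNorm z) =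
    ‖α‖ ^ 2 * ∑ k, c k * ‖z k‖ ^ 2 - (∑ k, c k * ‖z k‖ ^ 2) / sqNorm z * (2 * ‖α‖ * B) := by ring
  have h4 : (∑ k, c k - C) / (N - 1) * Λ = (∑ k, c k) * (Λ / (N - 1)) - C * (Λ / (N - 1)) := by
    ring
  rw [h3, h4]
  linarith

/-! ### Information density of the Gaussian test channel -/

/-- The log-likelihood ratio `log (p(y | u) / p(y))` of the scalar channel `y = α u + w` with
`u ~ CN(0, P)` and `w ~ CN(0, s)`. -/
noncomputable def gaussianInfoDensity (α : ℂ) (s P : ℝ) (u y : ℂ) : ℝ :=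
  -‖y - α * u‖ ^ 2 / s + ‖y‖ ^ 2 / (‖α‖ ^ 2 * P + s) + Real.log (1 + ‖α‖ ^ 2 * P / s)

lemma exp_gaussianInfoDensity_eq (α : ℂ) {s P : ℝ} (hs : 0 < s) (hP : 0 ≤ P) (u y : ℂ) :
    Real.exp (gaussianInfoDensity α s P u y) =
      (Real.exp (-‖y‖ ^ 2 / s + ‖y‖ ^ 2 / (‖α‖ ^ 2 * P + s)) * (1 + ‖α‖ ^ 2 * P / s)) *
        Real.exp (2 * (conj (y * conj α / (s : ℂ)) * u).re - ‖α‖ ^ 2 / s * ‖u‖ ^ 2) := by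
  have h1 : 0 < 1 + ‖α‖ ^ 2 * P / s := by positivity
  conv_rhs => enter [1, 2]; rw [← Real.exp_log h1]
  rw [← Real.exp_add, ← Real.exp_add, gaussianInfoDensity]
  congr 1
  have h2 : (conj (y * conj α / (s : ℂ)) * u).re = (y * conj (α * u)).re / s := by
    rw [map_div₀, map_mul, Complex.conj_conj, Complex.conj_ofReal, div_mul_eq_mul_div,
      Complex.div_ofReal_re, ← Complex.conj_re (y * _), map_mul, Complex.conj_conj, mul_assoc]
  rw [h2, Complex.sq_norm (y - _), Complex.normSq_sub, ← Complex.sq_norm, ← Complex.sq_norm,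
    norm_mul]
  ring

lemma integrable_exp_gaussianInfoDensity (α : ℂ) {s P : ℝ} (hs : 0 < s) (hP : 0 ≤ P) (y : ℂ) :
    Integrable (fun u => Real.exp (gaussianInfoDensity α s P u y)) (complexGaussian P) := by
  simp_rw [exp_gaussianInfoDensity_eq α hs hP]
  exact (integrable_exp_quadratic_complexGaussian P (by positivity) _).const_mul _

/-- Bayes' rule: p(y | u)/p(y) averages to one over the prior on u. It holds for each y separately,
which is what allows an arbitrary output law later. -/
lemma integral_exp_gaussianInfoDensity (α : ℂ) {s P : ℝ} (hs : 0 < s) (hP : 0 ≤ P) (y : ℂ) :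
    ∫ u, Real.exp (gaussianInfoDensity α s P u y) ∂(complexGaussian P) = 1 := by
  simp_rw [exp_gaussianInfoDensity_eq α hs hP]
  rw [integral_const_mul, integral_exp_quadratic_complexGaussian hP (by positivity)]
  have h1 : 0 < 1 + ‖α‖ ^ 2 * P / s := by positivity
  have h1' : 0 < 1 + ‖α‖ ^ 2 / s * P := by positivity
  have h2 : 0 < ‖α‖ ^ 2 * P + s := by positivity
  have h3 : -‖y‖ ^ 2 / s + ‖y‖ ^ 2 / (‖α‖ ^ 2 * P + s) +
      ‖y * conj α / (s : ℂ)‖ ^ 2 * P / (1 + ‖α‖ ^ 2 / s * P) = 0 := by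
    rw [norm_div, norm_mul, Complex.norm_real, RCLike.norm_conj, Real.norm_eq_abs,
      abs_of_pos hs]
    field_simp
    ring
  calc _ = ((1 + ‖α‖ ^ 2 * P / s) * (1 + ‖α‖ ^ 2 / s * P)⁻¹) *
        Real.exp (-‖y‖ ^ 2 / s + ‖y‖ ^ 2 / (‖α‖ ^ 2 * P + s) +
          ‖y * conj α / (s : ℂ)‖ ^ 2 * P / (1 + ‖α‖ ^ 2 / s * P)) := by
        rw [Real.exp_add (_ + _)]
        ring
    _ = 1 := by
        rw [h3, Real.exp_zero, show ‖α‖ ^ 2 * P / s = ‖α‖ ^ 2 / s * P by ring,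
          mul_inv_cancel₀ h1'.ne', one_mul]

/-- The information density of the Gaussian vector channel with independent components. -/
noncomputable def vectorInfoDensity {N : ℕ} (α : ℂ) (s : ℝ) (P : Fin N → ℝ)
    (p : (Fin N → ℂ) × (Fin N → ℂ)) : ℝ :=
  ∑ k, gaussianInfoDensity α s (P k) (p.1 k) (p.2 k)

lemma continuous_vectorInfoDensity {N : ℕ} (α : ℂ) (s : ℝ) (P : Fin N → ℝ) :
    Continuous (vectorInfoDensity α s P) := by
  unfold vectorInfoDensity gaussianInfoDensity
  fun_prop

lemma integral_exp_vectorInfoDensity {N : ℕ} (α : ℂ) {s : ℝ} {P : Fin N → ℝ} (hs : 0 < s)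
    (hP : ∀ k, 0 ≤ P k) (y : Fin N → ℂ) :
    ∫ z, Real.exp (vectorInfoDensity α s P (z, y)) ∂(Measure.pi fun k => complexGaussian (P k)) =
      1 := by
  simp_rw [vectorInfoDensity, Real.exp_sum]
  rw [integral_fintype_prod_eq_prod
    (f := fun k u => Real.exp (gaussianInfoDensity α s (P k) u (y k)))]
  simp [integral_exp_gaussianInfoDensity α hs (hP _)]

lemma integrable_exp_vectorInfoDensity {N : ℕ} (α : ℂ) {s : ℝ} {P : Fin N → ℝ} (hs : 0 < s)
    (hP : ∀ k, 0 ≤ P k) (q : Measure (Fin N → ℂ)) [IsProbabilityMeasure q] :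
    Integrable (fun p => Real.exp (vectorInfoDensity α s P p))
      ((Measure.pi fun k => complexGaussian (P k)).prod q) := by
  have hc : Continuous fun p => Real.exp (vectorInfoDensity α s P p) :=
    Real.continuous_exp.comp (continuous_vectorInfoDensity α s P)
  rw [integrable_prod_iff' hc.aestronglyMeasurable]
  constructor
  · refine ae_of_all _ fun y => ?_
    simp_rw [vectorInfoDensity, Real.exp_sum]
    exact Integrable.fintype_prod
      (f := fun k u => Real.exp (gaussianInfoDensity α s (P k) u (y k)))
      fun k => integrable_exp_gaussianInfoDensity α hs (hP k) _
  · simp only [Real.norm_eq_abs, Real.abs_exp, integral_exp_vectorInfoDensity α hs hP]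
    exact integrable_const _

/-- Mismatched-decoding lower bound for the mutual information with Gaussian inputs. -/
theorem ofReal_integral_vectorInfoDensity_le_mutualInfo {Ω : Type*} [MeasurableSpace Ω]
    {μ : Measure Ω} [IsProbabilityMeasure μ] {N : ℕ} (α : ℂ) {s : ℝ} {P : Fin N → ℝ} (hs : 0 < s)
    (hP : ∀ k, 0 ≤ P k) {X Y : Ω → Fin N → ℂ}
    (hX : HasLaw X (Measure.pi fun k => complexGaussian (P k)) μ) (hY : AEMeasurable Y μ)
    (hint : Integrable (fun ω => vectorInfoDensity α s P (X ω, Y ω)) μ) :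
    ENNReal.ofReal (∫ ω, vectorInfoDensity α s P (X ω, Y ω) ∂μ) ≤ mutualInfo μ X Y := by
  have hXY : AEMeasurable (fun ω => (X ω, Y ω)) μ := hX.aemeasurable.prodMk hY
  have hT := (continuous_vectorInfoDensity α s P).aestronglyMeasurable
    (μ := μ.map fun ω => (X ω, Y ω))
  have := Measure.isProbabilityMeasure_map hXY
  have := Measure.isProbabilityMeasure_map hX.aemeasurable
  have := Measure.isProbabilityMeasure_map hY
  rw [mutualInfo, ← integral_map (f := vectorInfoDensity α s P) hXY hT]
  refine ofReal_integral_le_klDiv _ _ ((integrable_map_measure hT hXY).mpr hint) ?_ ?_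
  · rw [hX.map_eq]
    exact integrable_exp_vectorInfoDensity α hs hP _
  · have h := integrable_exp_vectorInfoDensity α hs hP (μ.map Y)
    rw [hX.map_eq, integral_prod_symm _ h]
    simp [integral_exp_vectorInfoDensity α hs hP]

/-! ### Second moments of independent sums -/

section IndependentSums

variable {ι : Type*} [Fintype ι] {E : ι → Type*} [∀ i, MeasurableSpace (E i)]
  {μ : ∀ i, Measure (E i)} [∀ i, IsProbabilityMeasure (μ i)] {X : ∀ i, E i → ℝ}

lemma memLp_sum_pi (h : ∀ i, MemLp (X i) 2 (μ i)) :
    MemLp (fun z : ∀ i, E i => ∑ i, X i (z i)) 2 (Measure.pi μ) :=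
  memLp_finsetSum _ fun i _ => (h i).comp_measurePreserving (measurePreserving_eval μ i)

lemma integral_sum_sq_pi (h : ∀ i, MemLp (X i) 2 (μ i)) (h0 : ∀ i, ∫ x, X i x ∂(μ i) = 0) :
    ∫ z, (∑ i, X i (z i)) ^ 2 ∂(Measure.pi μ) = ∑ i, ∫ x, X i x ^ 2 ∂(μ i) := by
  have hv := variance_sum_pi h
  have he : (∑ i, fun ω : ∀ i, E i => X i (ω i)) = fun z => ∑ i, X i (z i) := by
    ext z
    simp
  have hm : ∫ z, ∑ i, X i (z i) ∂(Measure.pi μ) = 0 := by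
    rw [integral_finsetSum]
    · refine Finset.sum_eq_zero fun i _ => ?_
      rw [← h0 i]
      exact integral_comp_eval (h i).aestronglyMeasurable
    · exact fun i _ => ((h i).comp_measurePreserving (measurePreserving_eval μ i)).integrable
        (by norm_num)
  rw [he, variance_of_integral_eq_zero (memLp_sum_pi h).aestronglyMeasurable.aemeasurable hm] at hv
  rw [hv]
  refine Finset.sum_congr rfl fun i _ => ?_
  exact variance_of_integral_eq_zero (h i).aestronglyMeasurable.aemeasurable (h0 i)

end IndependentSums

lemma memLp_norm_sq_sub_complexGaussian (v c : ℝ) :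
    MemLp (fun u : ℂ => ‖u‖ ^ 2 - c) 2 (complexGaussian v) := by
  rw [memLp_two_iff_integrable_sq (by fun_prop)]
  have : (fun u : ℂ => (‖u‖ ^ 2 - c) ^ 2) = fun u => ‖u‖ ^ 4 - 2 * c * ‖u‖ ^ 2 + c ^ 2 := by
    ext u
    ring
  rw [this]
  exact ((integrable_norm_pow_complexGaussian v 4).sub
    ((integrable_norm_pow_complexGaussian v 2).const_mul _)).add (integrable_const _)

lemma integral_norm_sq_sub_complexGaussian {v : ℝ} (hv : 0 ≤ v) :
    ∫ u : ℂ, (‖u‖ ^ 2 - v) ∂(complexGaussian v) = 0 := by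
  rw [integral_sub (integrable_norm_pow_complexGaussian v 2) (integrable_const _),
    integral_norm_sq_complexGaussian hv]
  simp

lemma sqNorm_sub_eq_sum {N : ℕ} (P : Fin N → ℝ) (z : Fin N → ℂ) :
    sqNorm z - ∑ k, P k = ∑ k, (‖z k‖ ^ 2 - P k) := by
  rw [Finset.sum_sub_distrib, sqNorm]

lemma memLp_sqNorm_sub {N : ℕ} (P : Fin N → ℝ) (c : ℝ) :
    MemLp (fun z : Fin N → ℂ => sqNorm z - c) 2
      (Measure.pi fun k => complexGaussian (P k)) := by
  have h := memLp_sum_pi (X := fun (k : Fin N) (u : ℂ) => ‖u‖ ^ 2 - 0)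
    fun k => memLp_norm_sq_sub_complexGaussian (P k) 0
  refine (h.sub (memLp_const c)).ae_eq (ae_of_all _ fun z => ?_)
  simp [sqNorm]

lemma integral_sqNorm_sub_sq {N : ℕ} {P : Fin N → ℝ} (hP : ∀ k, 0 ≤ P k) :
    ∫ z, (sqNorm z - ∑ k, P k) ^ 2 ∂(Measure.pi fun k => complexGaussian (P k)) =
      ∑ k, ∫ u, (‖u‖ ^ 2 - P k) ^ 2 ∂(complexGaussian (P k)) := by
  simp_rw [sqNorm_sub_eq_sum]
  exact integral_sum_sq_pi (X := fun (k : Fin N) (u : ℂ) => ‖u‖ ^ 2 - P k)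
    (fun k => memLp_norm_sq_sub_complexGaussian (P k) _)
    fun k => integral_norm_sq_sub_complexGaussian (hP k)

lemma integrable_norm_sq_eval {N : ℕ} (P : Fin N → ℝ) (k : Fin N) :
    Integrable (fun z : Fin N → ℂ => ‖z k‖ ^ 2) (Measure.pi fun k => complexGaussian (P k)) :=
  integrable_comp_eval (μ := fun k => complexGaussian (P k)) (i := k)
    (f := fun u : ℂ => ‖u‖ ^ 2) (integrable_norm_pow_complexGaussian (P k) 2)

lemma integral_norm_sq_eval {N : ℕ} {P : Fin N → ℝ} (hP : ∀ k, 0 ≤ P k) (k : Fin N) :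
    ∫ z, ‖z k‖ ^ 2 ∂(Measure.pi fun k => complexGaussian (P k)) = P k := by
  rw [← integral_norm_sq_complexGaussian (hP k)]
  exact integral_comp_eval (μ := fun k => complexGaussian (P k)) (i := k)
    (f := fun u : ℂ => ‖u‖ ^ 2) (by fun_prop)

lemma integrable_sqNorm {N : ℕ} (P : Fin N → ℝ) :
    Integrable (sqNorm : (Fin N → ℂ) → ℝ) (Measure.pi fun k => complexGaussian (P k)) :=
  integrable_finsetSum _ fun k _ => integrable_norm_sq_eval P k

lemma integral_sqNorm {N : ℕ} {P : Fin N → ℝ} (hP : ∀ k, 0 ≤ P k) :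
    ∫ z, sqNorm z ∂(Measure.pi fun k => complexGaussian (P k)) = ∑ k, P k := by
  unfold sqNorm
  rw [integral_finsetSum _ fun k _ => integrable_norm_sq_eval P k]
  exact Finset.sum_congr rfl fun k _ => integral_norm_sq_eval hP k

/-! ### Componentwise Lipschitz maps of white noise -/

lemma norm_le_of_lipschitzWith {L : ℝ≥0} {d : ℂ → ℂ} (hd : LipschitzWith L d) (u : ℂ) :
    ‖d u‖ ≤ ‖d 0‖ + L * ‖u‖ := by
  have h1 := hd.norm_sub_le u 0
  have h2 := norm_sub_norm_le (d u) (d 0)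
  rw [sub_zero] at h1
  linarith

lemma norm_sq_le_of_lipschitzWith {L : ℝ≥0} {d : ℂ → ℂ} (hd : LipschitzWith L d) (u : ℂ) :
    ‖d u‖ ^ 2 ≤ 2 * ‖d 0‖ ^ 2 + 2 * L ^ 2 * ‖u‖ ^ 2 := by
  have h := pow_le_pow_left₀ (norm_nonneg _) (norm_le_of_lipschitzWith hd u) 2
  nlinarith [sq_nonneg (‖d 0‖ - L * ‖u‖)]

lemma sqNorm_comp_le {N : ℕ} {L : ℝ≥0} {d : ℂ → ℂ} (hd : LipschitzWith L d) (w : Fin N → ℂ) :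
    sqNorm (fun n => d (w n)) ≤ 2 * ‖d 0‖ ^ 2 * N + 2 * L ^ 2 * sqNorm w := by
  calc sqNorm (fun n => d (w n)) ≤ ∑ n, (2 * ‖d 0‖ ^ 2 + 2 * L ^ 2 * ‖w n‖ ^ 2) :=
        Finset.sum_le_sum fun n _ => norm_sq_le_of_lipschitzWith hd (w n)
    _ = _ := by
        rw [Finset.sum_add_distrib, sqNorm, Finset.mul_sum]
        simp only [Finset.sum_const, Finset.card_univ, Fintype.card_fin, nsmul_eq_mul]
        ring

lemma integrable_norm_sq_lipschitz {L : ℝ≥0} {d : ℂ → ℂ} (hd : LipschitzWith L d) (v : ℝ) :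
    Integrable (fun u => ‖d u‖ ^ 2) (complexGaussian v) := by
  have hc := hd.continuous
  refine ((integrable_const (2 * ‖d 0‖ ^ 2)).add
    ((integrable_norm_pow_complexGaussian v 2).const_mul (2 * L ^ 2))).mono'
    (by fun_prop) (ae_of_all _ fun u => ?_)
  rw [Real.norm_of_nonneg (by positivity)]
  exact norm_sq_le_of_lipschitzWith hd u

lemma memLp_conj_mul_lipschitz {L : ℝ≥0} {d : ℂ → ℂ} (hd : LipschitzWith L d) (v : ℝ) :
    MemLp (fun u => conj u * d u) 2 (complexGaussian v) := by
  have hc := hd.continuous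
  have hm : AEStronglyMeasurable (fun u => conj u * d u) (complexGaussian v) :=
    (Complex.continuous_conj.mul hc).aestronglyMeasurable
  rw [memLp_two_iff_integrable_sq_norm hm]
  refine (((integrable_norm_pow_complexGaussian v 2).const_mul (2 * ‖d 0‖ ^ 2)).add
    ((integrable_norm_pow_complexGaussian v 4).const_mul (2 * L ^ 2))).mono'
    (hm.norm.pow 2) (ae_of_all _ fun u => ?_)
  rw [Real.norm_of_nonneg (by positivity), norm_mul, RCLike.norm_conj, mul_pow]
  have := mul_le_mul_of_nonneg_left (norm_sq_le_of_lipschitzWith hd u) (sq_nonneg ‖u‖)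
  simp only [Pi.add_apply]
  nlinarith

lemma norm_sq_sum_eq {ι : Type*} [Fintype ι] (h : ι → ℂ) :
    ‖∑ n, h n‖ ^ 2 = (∑ n, (h n).re) ^ 2 + (∑ n, (h n).im) ^ 2 := by
  rw [Complex.sq_norm, Complex.normSq_apply, Complex.re_sum, Complex.im_sum]
  ring

lemma integrable_norm_sq_star_dotProduct {N : ℕ} {L : ℝ≥0} {d : ℂ → ℂ}
    (hd : LipschitzWith L d) (v : ℝ) :
    Integrable (fun g : Fin N → ℂ => ‖star g ⬝ᵥ fun n => d (g n)‖ ^ 2)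
      (Measure.pi fun _ : Fin N => complexGaussian v) := by
  have hL := memLp_conj_mul_lipschitz hd v
  have h1 := (memLp_sum_pi (μ := fun _ : Fin N => complexGaussian v) fun _ => hL.re).integrable_sq
  have h2 := (memLp_sum_pi (μ := fun _ : Fin N => complexGaussian v) fun _ => hL.im).integrable_sq
  refine (h1.add h2).congr (ae_of_all _ fun g => ?_)
  exact (norm_sq_sum_eq fun n => conj (g n) * d (g n)).symm

/-- The summands are independent and centred by the orthogonality hypothesis, so the second moment
grows like N rather than N². -/
lemma integral_norm_sq_star_dotProduct {N : ℕ} {L : ℝ≥0} {d : ℂ → ℂ}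
    (hd : LipschitzWith L d) {v : ℝ} (h0 : ∫ u, conj u * d u ∂(complexGaussian v) = 0) :
    ∫ g : Fin N → ℂ, ‖star g ⬝ᵥ fun n => d (g n)‖ ^ 2
      ∂(Measure.pi fun _ : Fin N => complexGaussian v) =
        N * ∫ u, ‖conj u * d u‖ ^ 2 ∂(complexGaussian v) := by
  have hL := memLp_conj_mul_lipschitz hd v
  have hi := hL.integrable (by norm_num)
  have hre : ∫ u, (conj u * d u).re ∂(complexGaussian v) = 0 := by
    have := integral_re hi
    rw [h0] at this
    simpa using this
  have him : ∫ u, (conj u * d u).im ∂(complexGaussian v) = 0 := by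
    have := integral_im hi
    rw [h0] at this
    simpa using this
  have h1 := memLp_sum_pi (μ := fun _ : Fin N => complexGaussian v) fun _ => hL.re
  have h2 := memLp_sum_pi (μ := fun _ : Fin N => complexGaussian v) fun _ => hL.im
  have e1 := integral_sum_sq_pi (μ := fun _ : Fin N => complexGaussian v) (fun _ => hL.re)
    fun _ => hre
  have e2 := integral_sum_sq_pi (μ := fun _ : Fin N => complexGaussian v) (fun _ => hL.im)
    fun _ => him
  have e : ∀ g : Fin N → ℂ, ‖star g ⬝ᵥ fun n => d (g n)‖ ^ 2 =
      (∑ n, RCLike.re (conj (g n) * d (g n))) ^ 2 + (∑ n, RCLike.im (conj (g n) * d (g n))) ^ 2 :=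
    fun g => norm_sq_sum_eq fun n => conj (g n) * d (g n)
  simp_rw [e]
  rw [integral_add h1.integrable_sq h2.integrable_sq, e1, e2]
  simp only [Finset.sum_const, Finset.card_univ, Fintype.card_fin, nsmul_eq_mul]
  rw [← mul_add, ← integral_add hL.re.integrable_sq hL.im.integrable_sq]
  congr 2
  ext u
  rw [Complex.sq_norm, Complex.normSq_apply]
  simp [sq]

lemma integrable_sqNorm_comp {N : ℕ} {L : ℝ≥0} {d : ℂ → ℂ} (hd : LipschitzWith L d) (v : ℝ) :
    Integrable (fun g : Fin N → ℂ => sqNorm fun n => d (g n))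
      (Measure.pi fun _ : Fin N => complexGaussian v) :=
  integrable_finsetSum _ fun n _ =>
    integrable_comp_eval (μ := fun _ : Fin N => complexGaussian v) (i := n)
      (f := fun u : ℂ => ‖d u‖ ^ 2) (integrable_norm_sq_lipschitz hd v)

lemma integral_sqNorm_comp {N : ℕ} {L : ℝ≥0} {d : ℂ → ℂ} (hd : LipschitzWith L d) (v : ℝ) :
    ∫ g : Fin N → ℂ, sqNorm (fun n => d (g n)) ∂(Measure.pi fun _ : Fin N => complexGaussian v) =
      N * ∫ u, ‖d u‖ ^ 2 ∂(complexGaussian v) := by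
  unfold sqNorm
  rw [integral_finsetSum _ fun n _ =>
    integrable_comp_eval (μ := fun _ : Fin N => complexGaussian v) (i := n)
      (f := fun u : ℂ => ‖d u‖ ^ 2) (integrable_norm_sq_lipschitz hd v)]
  have : ∀ n : Fin N, ∫ g : Fin N → ℂ, ‖d (g n)‖ ^ 2
      ∂(Measure.pi fun _ : Fin N => complexGaussian v) = ∫ u, ‖d u‖ ^ 2 ∂(complexGaussian v) :=
    fun n => integral_comp_eval (μ := fun _ : Fin N => complexGaussian v) (i := n)
      (f := fun u : ℂ => ‖d u‖ ^ 2) (integrable_norm_sq_lipschitz hd v).aestronglyMeasurable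
  simp [this]

/-! ### Deterministic comparison inequalities -/

lemma norm_star_dotProduct_sq_le {N : ℕ} (p q : Fin N → ℂ) :
    ‖star p ⬝ᵥ q‖ ^ 2 ≤ sqNorm p * sqNorm q := by
  have h := norm_inner_le_norm (𝕜 := ℂ) (WithLp.toLp 2 p) (WithLp.toLp 2 q)
  rw [EuclideanSpace.inner_toLp_toLp, dotProduct_comm] at h
  rw [sqNorm_eq_norm_sq, sqNorm_eq_norm_sq, ← mul_pow]
  exact pow_le_pow_left₀ (norm_nonneg _) h 2

lemma sqNorm_comp_sub_le {N : ℕ} {L : ℝ≥0} {d : ℂ → ℂ} (hd : LipschitzWith L d)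
    (w g : Fin N → ℂ) :
    sqNorm (fun n => d (w n) - d (g n)) ≤ L ^ 2 * sqNorm (w - g) := by
  rw [sqNorm, sqNorm, Finset.mul_sum]
  refine Finset.sum_le_sum fun n _ => ?_
  rw [← mul_pow]
  exact pow_le_pow_left₀ (norm_nonneg _) (hd.norm_sub_le _ _) 2

lemma sqNorm_rescaleTo_sub {N : ℕ} (z : Fin N → ℂ) {g : Fin N → ℂ} (hg : g ≠ 0) :
    sqNorm (rescaleTo z g - g) = (√(sqNorm z) - √(sqNorm g)) ^ 2 := by
  have hS : 0 < sqNorm g := lt_of_le_of_ne (sqNorm_nonneg g)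
    fun h => hg (sqNorm_eq_zero.mp h.symm)
  have h1 : rescaleTo z g - g = (((√(sqNorm z) / √(sqNorm g) - 1 : ℝ) : ℂ)) • g := by
    rw [rescaleTo, Complex.ofReal_sub, Complex.ofReal_one, sub_smul, one_smul]
  rw [h1, sqNorm_smul, Complex.norm_real, Real.norm_eq_abs, sq_abs]
  have hr : √(sqNorm g) ≠ 0 := by positivity
  conv_lhs => enter [2]; rw [← Real.sq_sqrt hS.le]
  rw [← mul_pow]
  congr 1
  field_simp

/-- Factor the difference of squares and apply weighted AM-GM. The free η lets a bounded discrepancy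
be paid for with a small fraction of the total energy. -/
lemma abs_sqNorm_sub_sqNorm_le {N : ℕ} (a b : Fin N → ℂ) {η : ℝ} (hη : 0 < η) :
    |sqNorm a - sqNorm b| ≤ (1 + 1 / η) * sqNorm (fun n => a n - b n) + η * sqNorm b := by
  have h1 : ∀ x y : ℂ, |‖x‖ ^ 2 - ‖y‖ ^ 2| ≤ (1 + 1 / η) * ‖x - y‖ ^ 2 + η * ‖y‖ ^ 2 := by
    intro x y
    have h2 := abs_norm_sub_norm_le x y
    have h3 : |‖x‖ ^ 2 - ‖y‖ ^ 2| = |‖x‖ - ‖y‖| * (‖x‖ + ‖y‖) := by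
      conv_rhs => enter [2]; rw [← abs_of_nonneg (by positivity : 0 ≤ ‖x‖ + ‖y‖)]
      rw [← abs_mul]
      congr 1
      ring
    have h4 : ‖x‖ ≤ ‖x - y‖ + ‖y‖ := by
      have := norm_sub_norm_le x y
      linarith
    have h5 : 2 * ‖x - y‖ * ‖y‖ ≤ 1 / η * ‖x - y‖ ^ 2 + η * ‖y‖ ^ 2 := by
      have h6 : 1 / η * ‖x - y‖ ^ 2 + η * ‖y‖ ^ 2 - 2 * ‖x - y‖ * ‖y‖ =
          (‖x - y‖ - η * ‖y‖) ^ 2 / η := by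
        field_simp
        ring
      have : 0 ≤ (‖x - y‖ - η * ‖y‖) ^ 2 / η := by positivity
      linarith
    rw [h3]
    calc |‖x‖ - ‖y‖| * (‖x‖ + ‖y‖) ≤ ‖x - y‖ * (‖x - y‖ + ‖y‖ + ‖y‖) := by gcongr
      _ ≤ _ := by nlinarith
  rw [sqNorm, sqNorm, sqNorm, ← Finset.sum_sub_distrib, Finset.mul_sum, Finset.mul_sum,
    ← Finset.sum_add_distrib]
  exact (Finset.abs_sum_le_sum_abs _ _).trans (Finset.sum_le_sum fun n _ => h1 _ _)

lemma sq_sqrt_sub_le {S v : ℝ} (hS : 0 ≤ S) (hv : 0 < v) :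
    (√S - √v) ^ 2 ≤ (S - v) ^ 2 / v := by
  rw [le_div_iff₀ hv]
  have h1 := Real.sq_sqrt hS
  have h2 := Real.sq_sqrt hv.le
  have h3 : S - v = (√S - √v) * (√S + √v) := by nlinarith
  have h4 : v ≤ (√S + √v) ^ 2 := by
    nlinarith [mul_nonneg (Real.sqrt_nonneg S) (Real.sqrt_nonneg v)]
  rw [h3, mul_pow]
  exact mul_le_mul_of_nonneg_left h4 (sq_nonneg _)

lemma pow_four_sqrt_sub_le {S v : ℝ} (hS : 0 ≤ S) (hv : 0 ≤ v) :
    (√S - √v) ^ 4 ≤ (S - v) ^ 2 := by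
  have h1 := Real.sq_sqrt hS
  have h2 := Real.sq_sqrt hv
  have h3 : S - v = (√S - √v) * (√S + √v) := by nlinarith
  have hs := Real.sqrt_nonneg S
  have hv' := Real.sqrt_nonneg v
  have h4 : (√S - √v) ^ 2 ≤ (√S + √v) ^ 2 := by nlinarith
  rw [h3, mul_pow, show (√S - √v) ^ 4 = (√S - √v) ^ 2 * (√S - √v) ^ 2 by ring]
  gcongr

lemma sq_sqrt_sub_sqrt_le {S T v : ℝ} (hS : 0 ≤ S) (hT : 0 ≤ T) (hv : 0 < v) :
    (√S - √T) ^ 2 ≤ 2 * ((S - v) ^ 2 / v) + 2 * ((T - v) ^ 2 / v) := by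
  have h1 := sq_sqrt_sub_le hS hv
  have h2 := sq_sqrt_sub_le hT hv
  nlinarith [sq_nonneg ((√S - √v) + (√T - √v))]

/-- Deterministic bound for the normalized correlation between a vector and its image under a
componentwise Lipschitz map. -/
lemma norm_star_dotProduct_sq_div_le {N : ℕ} (hN : 0 < N) {L : ℝ≥0} {d : ℂ → ℂ}
    (hd : LipschitzWith L d) {v : ℝ} (hv : 0 < v) (g : Fin N → ℂ) :
    ‖star g ⬝ᵥ fun n => d (g n)‖ ^ 2 / sqNorm g ≤
      (2 * ‖star g ⬝ᵥ fun n => d (g n)‖ ^ 2 +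
        2 * (2 * ‖d 0‖ ^ 2 / v + 8 * L ^ 2) * (sqNorm g - N * v) ^ 2) / (N * v) := by
  have hNv : 0 < (N : ℝ) * v := by positivity
  have hS := sqNorm_nonneg g
  rcases hS.eq_or_lt with h0 | hSpos
  · rw [← h0, div_zero]
    positivity
  set q := ‖star g ⬝ᵥ fun n => d (g n)‖ ^ 2 with hq
  set b := sqNorm fun n => d (g n) with hb
  have hqb : q ≤ sqNorm g * b := norm_star_dotProduct_sq_le _ _
  have hq0 : 0 ≤ q := by positivity
  set t := √(sqNorm g) with ht
  set t0 := √((N : ℝ) * v) with ht0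
  have ht2 : t ^ 2 = sqNorm g := Real.sq_sqrt hS
  have ht02 : t0 ^ 2 = (N : ℝ) * v := Real.sq_sqrt hNv.le
  have hbL : b ≤ 2 * ‖d 0‖ ^ 2 * N + 2 * L ^ 2 * sqNorm g := sqNorm_comp_le hd g
  have e1 : (t - t0) ^ 2 ≤ (sqNorm g - N * v) ^ 2 / (N * v) := sq_sqrt_sub_le hS hNv
  have e2 : (t - t0) ^ 4 ≤ (sqNorm g - N * v) ^ 2 := pow_four_sqrt_sub_le hS hNv.le
  have hb2 : b * (t - t0) ^ 2 ≤ (2 * ‖d 0‖ ^ 2 / v + 8 * L ^ 2) * (sqNorm g - N * v) ^ 2 := by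
    have hg2 : sqNorm g ≤ 2 * ((N : ℝ) * v) + 2 * (t - t0) ^ 2 := by
      rw [← ht2, ← ht02]
      nlinarith [sq_nonneg (t - 2 * t0)]
    have hb3 : b ≤ (2 * ‖d 0‖ ^ 2 / v + 4 * L ^ 2) * (N * v) + 4 * L ^ 2 * (t - t0) ^ 2 := by
      have h5 : (2 * ‖d 0‖ ^ 2 / v + 4 * L ^ 2) * (N * v) =
          2 * ‖d 0‖ ^ 2 * N + 4 * L ^ 2 * (N * v) := by
        field_simp
      have := mul_le_mul_of_nonneg_left hg2 (by positivity : (0 : ℝ) ≤ 2 * L ^ 2)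
      rw [h5]
      linarith
    have h6 := mul_le_mul_of_nonneg_right hb3 (sq_nonneg (t - t0))
    have h7 := mul_le_mul_of_nonneg_left e1
      (by positivity : 0 ≤ (2 * ‖d 0‖ ^ 2 / v + 4 * L ^ 2) * (N * v))
    have h8 := mul_le_mul_of_nonneg_left e2 (by positivity : (0 : ℝ) ≤ 4 * L ^ 2)
    have h9 : (2 * ‖d 0‖ ^ 2 / v + 4 * L ^ 2) * (N * v) *
        ((sqNorm g - N * v) ^ 2 / (N * v)) =
          (2 * ‖d 0‖ ^ 2 / v + 4 * L ^ 2) * (sqNorm g - N * v) ^ 2 := by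
      field_simp
    have h10 : (t - t0) ^ 2 * (t - t0) ^ 2 = (t - t0) ^ 4 := by ring
    linarith
  rw [div_le_div_iff₀ hSpos hNv]
  -- The denominator ‖g‖² may be far below Nv, so t0² is split as at most 2t² + 2(t - t0)². The
  -- first part cancels the denominator; for the second, Cauchy-Schwarz extracts a factor ‖g‖² from
  -- q.
  have h10 : q * (N * v) ≤ 2 * (q * sqNorm g) + 2 * (q * (t - t0) ^ 2) := by
    rw [← ht02, ← ht2]
    nlinarith [mul_nonneg hq0 (sq_nonneg (2 * t - t0))]
  have h11 := mul_le_mul_of_nonneg_right hqb (sq_nonneg (t - t0))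
  have h12 := mul_le_mul_of_nonneg_left hb2 hSpos.le
  linarith

/-- The law is that of a Haar-rotated vector, hence the image of a compact group, on which F is
bounded; no growth condition on F is needed. -/
lemma integrable_rescaleTo {N : ℕ} (hN : 0 < N) {v : ℝ} (hv : 0 < v) (z : Fin N → ℂ)
    {F : (Fin N → ℂ) → ℝ} (hF : Continuous F) :
    Integrable (fun g => F (rescaleTo z g)) (Measure.pi fun _ : Fin N => complexGaussian v) := by
  have hmz : Continuous fun V : Matrix.unitaryGroup (Fin N) ℂ =>
      (V : Matrix (Fin N) (Fin N) ℂ)ᴴ *ᵥ z :=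
    continuous_coe_unitaryGroup.matrix_conjTranspose.matrix_mulVec continuous_const
  have hm : AEMeasurable (fun V : Matrix.unitaryGroup (Fin N) ℂ =>
      (V : Matrix (Fin N) (Fin N) ℂ)ᴴ *ᵥ z) (haarUnitary N) := hmz.measurable.aemeasurable
  have hi : Integrable (F ∘ fun V : Matrix.unitaryGroup (Fin N) ℂ =>
      (V : Matrix (Fin N) (Fin N) ℂ)ᴴ *ᵥ z) (haarUnitary N) :=
    integrable_haarUnitary (hF.comp hmz)
  rw [← integrable_map_measure hF.aestronglyMeasurable hm, map_haarUnitary_mulVec hN hv z,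
    integrable_map_measure hF.aestronglyMeasurable (measurable_rescaleTo z).aemeasurable] at hi
  exact hi

lemma integrable_sqNorm_sub_sq {N : ℕ} (P : Fin N → ℝ) (c : ℝ) :
    Integrable (fun z : Fin N → ℂ => (sqNorm z - c) ^ 2)
      (Measure.pi fun k => complexGaussian (P k)) :=
  (memLp_sqNorm_sub P c).integrable_sq

lemma integral_sqNorm_sub_sq_const {N : ℕ} {v : ℝ} (hv : 0 ≤ v) :
    ∫ z : Fin N → ℂ, (sqNorm z - N * v) ^ 2 ∂(Measure.pi fun _ : Fin N => complexGaussian v) =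
      N * ∫ u, (‖u‖ ^ 2 - v) ^ 2 ∂(complexGaussian v) := by
  have := integral_sqNorm_sub_sq (P := fun _ : Fin N => v) fun _ => hv
  simpa using this

/-! ### Coupling a rotated vector with white noise -/

/-- The squared deviation of `‖z‖²` from `N v`, divided by `N`. -/
noncomputable def normDeviation {N : ℕ} (v : ℝ) (z : Fin N → ℂ) : ℝ :=
  (sqNorm z - N * v) ^ 2 / N

lemma normDeviation_nonneg {N : ℕ} (v : ℝ) (z : Fin N → ℂ) : 0 ≤ normDeviation v z := by
  unfold normDeviation
  positivity

section RescaledEstimates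

variable {N : ℕ} {L : ℝ≥0} {d : ℂ → ℂ} {v : ℝ}

lemma continuous_componentwise (hd : LipschitzWith L d) :
    Continuous fun (w : Fin N → ℂ) (n : Fin N) => d (w n) := by
  have := hd.continuous
  fun_prop

/-- An integrable majorant, up to constants, for the squared distance of `g` and its rescaling to
the norm of `z`. -/
noncomputable def rescaleMajorant (v : ℝ) (z g : Fin N → ℂ) : ℝ :=
  2 * ((sqNorm z - N * v) ^ 2 / (N * v)) + 2 * ((sqNorm g - N * v) ^ 2 / (N * v))

lemma integrable_rescaleMajorant (z : Fin N → ℂ) :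
    Integrable (rescaleMajorant v z) (Measure.pi fun _ : Fin N => complexGaussian v) :=
  (integrable_const _).add (((integrable_sqNorm_sub_sq _ _).div_const _).const_mul _)

lemma integral_rescaleMajorant (hN : 0 < N) (hv : 0 < v) (z : Fin N → ℂ) :
    ∫ g, rescaleMajorant v z g ∂(Measure.pi fun _ : Fin N => complexGaussian v) =
      2 / v * (normDeviation v z + ∫ u, (‖u‖ ^ 2 - v) ^ 2 ∂(complexGaussian v)) := by
  unfold rescaleMajorant
  rw [integral_add (integrable_const _) (((integrable_sqNorm_sub_sq _ _).div_const _).const_mul _),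
    integral_const, integral_const_mul, integral_div, integral_sqNorm_sub_sq_const hv.le,
    normDeviation, probReal_univ, one_smul]
  have : (N : ℝ) ≠ 0 := by positivity
  field_simp

lemma sqNorm_comp_rescaleTo_sub_le (hN : 0 < N) (hd : LipschitzWith L d) (hv : 0 < v)
    (z : Fin N → ℂ) {g : Fin N → ℂ} (hg : g ≠ 0) :
    sqNorm (fun n => d (rescaleTo z g n) - d (g n)) ≤ L ^ 2 * rescaleMajorant v z g := by
  refine (sqNorm_comp_sub_le hd _ _).trans (mul_le_mul_of_nonneg_left ?_ (by positivity))
  rw [sqNorm_rescaleTo_sub z hg]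
  exact sq_sqrt_sub_sqrt_le (sqNorm_nonneg _) (sqNorm_nonneg _) (by positivity)

/-- The rotated vector is coupled with g itself. They differ by a radial displacement whose mean
square depends on N only through `normDeviation`, and a Lipschitz d preserves this order. -/
lemma abs_integral_sqNorm_conjTransform_sub_le (hN : 0 < N) (hd : LipschitzWith L d) (hv : 0 < v)
    (z : Fin N → ℂ) {η : ℝ} (hη : 0 < η) :
    |∫ V, sqNorm (conjTransform (fun w n => d (w n)) z V) ∂(haarUnitary N) -
        N * ∫ u, ‖d u‖ ^ 2 ∂(complexGaussian v)| ≤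
      (1 + 1 / η) * (L ^ 2 * (2 / v * (normDeviation v z +
        ∫ u, (‖u‖ ^ 2 - v) ^ 2 ∂(complexGaussian v)))) +
        η * (N * ∫ u, ‖d u‖ ^ 2 ∂(complexGaussian v)) := by
  have hcF : Continuous fun w : Fin N → ℂ => sqNorm fun n => d (w n) :=
    continuous_sqNorm.comp (continuous_componentwise hd)
  simp_rw [sqNorm_conjTransform]
  rw [integral_haarUnitary_mulVec hN hv z hcF, ← integral_sqNorm_comp hd v,
    ← integral_rescaleMajorant hN hv z, ← integral_sub (integrable_rescaleTo hN hv z hcF)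
      (integrable_sqNorm_comp hd v), ← integral_const_mul, ← integral_const_mul,
    ← integral_const_mul, ← integral_add (((integrable_rescaleMajorant z).const_mul _).const_mul _)
      ((integrable_sqNorm_comp hd v).const_mul _)]
  refine (abs_integral_le_integral_abs).trans (integral_mono_ae
    ((integrable_rescaleTo hN hv z hcF).sub (integrable_sqNorm_comp hd v)).abs
    ((((integrable_rescaleMajorant z).const_mul _).const_mul _).add
      ((integrable_sqNorm_comp hd v).const_mul _)) ?_)
  filter_upwards [ae_pi_complexGaussian_ne_zero (P := fun _ : Fin N => v) (k := ⟨0, hN⟩) hv]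
    with g hg
  refine (abs_sqNorm_sub_sqNorm_le _ _ hη).trans (add_le_add_left ?_ _)
  exact mul_le_mul_of_nonneg_left (sqNorm_comp_rescaleTo_sub_le hN hd hv z hg) (by positivity)

lemma integral_norm_sq_star_dotProduct_conjTransform_le (hN : 0 < N) (hd : LipschitzWith L d)
    (hv : 0 < v) (h0 : ∫ u, conj u * d u ∂(complexGaussian v) = 0) (z : Fin N → ℂ) :
    ∫ V, ‖star z ⬝ᵥ conjTransform (fun w n => d (w n)) z V‖ ^ 2 / sqNorm z ∂(haarUnitary N) ≤
      2 * ((2 * ∫ u, ‖conj u * d u‖ ^ 2 ∂(complexGaussian v) +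
        2 * (2 * ‖d 0‖ ^ 2 / v + 8 * L ^ 2) *
          ∫ u, (‖u‖ ^ 2 - v) ^ 2 ∂(complexGaussian v)) / v) +
      2 * (L ^ 2 * (2 / v * (normDeviation v z +
        ∫ u, (‖u‖ ^ 2 - v) ^ 2 ∂(complexGaussian v)))) := by
  have hcd := continuous_componentwise (N := N) hd
  have hcF : Continuous fun w : Fin N → ℂ => ‖star w ⬝ᵥ fun n => d (w n)‖ ^ 2 / sqNorm z := by
    unfold dotProduct
    have := hd.continuous
    fun_prop
  simp_rw [star_dotProduct_conjTransform]
  rw [integral_haarUnitary_mulVec hN hv z hcF]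
  set γ := Measure.pi fun _ : Fin N => complexGaussian v with hγ
  have hi1 : Integrable (fun g : Fin N → ℂ => (2 * ‖star g ⬝ᵥ fun n => d (g n)‖ ^ 2 +
        2 * (2 * ‖d 0‖ ^ 2 / v + 8 * L ^ 2) * (sqNorm g - N * v) ^ 2) / (N * v)) γ :=
    (((integrable_norm_sq_star_dotProduct hd v).const_mul _).add
      ((integrable_sqNorm_sub_sq _ _).const_mul _)).div_const _
  have hN0 : (N : ℝ) ≠ 0 := by positivity
  have e1 : ∫ g : Fin N → ℂ, (2 * ‖star g ⬝ᵥ fun n => d (g n)‖ ^ 2 +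
        2 * (2 * ‖d 0‖ ^ 2 / v + 8 * L ^ 2) * (sqNorm g - N * v) ^ 2) / (N * v) ∂γ =
      (2 * ∫ u, ‖conj u * d u‖ ^ 2 ∂(complexGaussian v) +
        2 * (2 * ‖d 0‖ ^ 2 / v + 8 * L ^ 2) *
          ∫ u, (‖u‖ ^ 2 - v) ^ 2 ∂(complexGaussian v)) / v := by
    rw [integral_div, integral_add ((integrable_norm_sq_star_dotProduct hd v).const_mul _)
      ((integrable_sqNorm_sub_sq _ _).const_mul _), integral_const_mul, integral_const_mul,
      integral_sqNorm_sub_sq_const hv.le, integral_norm_sq_star_dotProduct hd h0]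
    field_simp
  rw [← e1, ← integral_rescaleMajorant hN hv z, ← integral_const_mul, ← integral_const_mul,
    ← integral_const_mul, ← integral_add (hi1.const_mul _)
      (((integrable_rescaleMajorant z).const_mul _).const_mul _)]
  refine integral_mono_ae (integrable_rescaleTo hN hv z hcF)
    ((hi1.const_mul _).add (((integrable_rescaleMajorant z).const_mul _).const_mul _)) ?_
  filter_upwards [ae_pi_complexGaussian_ne_zero (P := fun _ : Fin N => v) (k := ⟨0, hN⟩) hv]
    with g hg
  have hS : 0 < sqNorm g := lt_of_le_of_ne (sqNorm_nonneg g)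
    fun h => hg (sqNorm_eq_zero.mp h.symm)
  set x := star g ⬝ᵥ fun n => d (g n) with hx
  set y := star g ⬝ᵥ fun n => d (rescaleTo z g n) - d (g n) with hy
  -- The outer scale factor turns division by ‖z‖² into division by ‖g‖², leaving the correlation x
  -- of g with d(g) and the rescaling error y.
  have h1 : star (rescaleTo z g) ⬝ᵥ (fun n => d (rescaleTo z g n)) =
      ((√(sqNorm z) / √(sqNorm g) : ℝ) : ℂ) * (x + y) := by
    have h2 : (fun n => d (rescaleTo z g n)) =
        (fun n => d (g n)) + fun n => d (rescaleTo z g n) - d (g n) := by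
      ext n
      simp
    conv_lhs => enter [2]; rw [h2]
    conv_lhs => enter [1]; rw [rescaleTo]
    rw [star_smul, smul_dotProduct, dotProduct_add, ← hx, ← hy, smul_eq_mul]
    congr 1
    exact Complex.conj_ofReal _
  have h3 : ‖star (rescaleTo z g) ⬝ᵥ (fun n => d (rescaleTo z g n))‖ ^ 2 / sqNorm z ≤
      ‖x + y‖ ^ 2 / sqNorm g := by
    rw [h1, norm_mul, mul_pow, Complex.norm_real, Real.norm_eq_abs, sq_abs, div_pow,
      Real.sq_sqrt (sqNorm_nonneg _), Real.sq_sqrt (sqNorm_nonneg _)]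
    rcases (sqNorm_nonneg z).eq_or_lt with hz | hz
    · rw [← hz]
      simp only [zero_div, zero_mul]
      positivity
    · refine le_of_eq ?_
      field_simp
  have h4 : ‖x + y‖ ^ 2 / sqNorm g ≤ 2 * (‖x‖ ^ 2 / sqNorm g) + 2 * (‖y‖ ^ 2 / sqNorm g) := by
    rw [← mul_div_assoc, ← mul_div_assoc, ← add_div]
    gcongr
    have := pow_le_pow_left₀ (norm_nonneg _) (norm_add_le x y) 2
    nlinarith [sq_nonneg (‖x‖ - ‖y‖)]
  have h5 : ‖y‖ ^ 2 / sqNorm g ≤ L ^ 2 * rescaleMajorant v z g := by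
    rw [div_le_iff₀ hS, mul_comm]
    refine (norm_star_dotProduct_sq_le _ _).trans (mul_le_mul_of_nonneg_left ?_ hS.le)
    exact sqNorm_comp_rescaleTo_sub_le hN hd hv z hg
  have h6 := norm_star_dotProduct_sq_div_le hN hd hv g
  rw [← hx] at h6
  calc _ ≤ _ := h3
    _ ≤ _ := h4
    _ ≤ _ := by
      refine add_le_add (mul_le_mul_of_nonneg_left h6 (by norm_num))
        (mul_le_mul_of_nonneg_left h5 (by norm_num))

/-- AM-GM converts the second-moment bound into a first-moment bound at the cost of η‖z‖², which is
of order ηN. -/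
lemma integral_norm_star_dotProduct_conjTransform_le {D : (Fin N → ℂ) → (Fin N → ℂ)}
    (hD : Continuous D) {z : Fin N → ℂ} (hz : z ≠ 0) {η : ℝ} (hη : 0 < η) :
    ∫ V, ‖star z ⬝ᵥ conjTransform D z V‖ ∂(haarUnitary N) ≤ η * sqNorm z +
      1 / η * ∫ V, ‖star z ⬝ᵥ conjTransform D z V‖ ^ 2 / sqNorm z ∂(haarUnitary N) := by
  have hS : 0 < sqNorm z := lt_of_le_of_ne (sqNorm_nonneg z)
    fun h => hz (sqNorm_eq_zero.mp h.symm)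
  have hβc : Continuous fun V => star z ⬝ᵥ conjTransform D z V :=
    (continuous_star_dotProduct _).comp (continuous_conjTransform hD)
  have hi : Integrable (fun V => ‖star z ⬝ᵥ conjTransform D z V‖ ^ 2 / sqNorm z)
      (haarUnitary N) := integrable_haarUnitary (by fun_prop)
  have e : η * sqNorm z = ∫ _ : Matrix.unitaryGroup (Fin N) ℂ, η * sqNorm z ∂(haarUnitary N) := by
    simp
  rw [e, ← integral_const_mul, ← integral_add (integrable_const _) (hi.const_mul _)]
  refine integral_mono (integrable_haarUnitary (by fun_prop))
    ((integrable_const _).add (hi.const_mul _)) fun V => ?_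
  simp only
  set x := ‖star z ⬝ᵥ conjTransform D z V‖
  have h : η * sqNorm z + 1 / η * (x ^ 2 / sqNorm z) - x =
      ((η * sqNorm z - x / 2) ^ 2 + 3 / 4 * x ^ 2) / (η * sqNorm z) := by
    field_simp
    ring
  have : 0 ≤ ((η * sqNorm z - x / 2) ^ 2 + 3 / 4 * x ^ 2) / (η * sqNorm z) := by positivity
  linarith

end RescaledEstimates

/-- Asymptotics of the distortion energy and of its correlation with the input, uniformly in the
dimension. -/
theorem exists_distortion_bounds {L : ℝ≥0} {d : ℂ → ℂ} (hd : LipschitzWith L d) {v : ℝ}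
    (hv : 0 < v) (h0 : ∫ u, conj u * d u ∂(complexGaussian v) = 0) :
    ∃ C : ℝ, 0 ≤ C ∧ ∀ N : ℕ, 0 < N → ∀ z : Fin N → ℂ, z ≠ 0 → ∀ η : ℝ, 0 < η → η ≤ 1 →
      |∫ V, sqNorm (conjTransform (fun w n => d (w n)) z V) ∂(haarUnitary N) -
        N * ∫ u, ‖d u‖ ^ 2 ∂(complexGaussian v)| ≤
          C / η * (1 + normDeviation v z) + η * C * N ∧
      ∫ V, ‖star z ⬝ᵥ conjTransform (fun w n => d (w n)) z V‖ ^ 2 / sqNorm z ∂(haarUnitary N) ≤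
        C / η * (1 + normDeviation v z) ∧
      ∫ V, ‖star z ⬝ᵥ conjTransform (fun w n => d (w n)) z V‖ ∂(haarUnitary N) ≤
        η * sqNorm z + C / η ^ 2 * (1 + normDeviation v z) := by
  set V4 := ∫ u, (‖u‖ ^ 2 - v) ^ 2 ∂(complexGaussian v) with hV4
  set s := ∫ u, ‖d u‖ ^ 2 ∂(complexGaussian v) with hs
  set B := 2 * ((2 * ∫ u, ‖conj u * d u‖ ^ 2 ∂(complexGaussian v) +
        2 * (2 * ‖d 0‖ ^ 2 / v + 8 * L ^ 2) * V4) / v) with hB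
  have hV40 : 0 ≤ V4 := integral_nonneg fun u => by positivity
  have hs0 : 0 ≤ s := integral_nonneg fun u => by positivity
  have hH0 : 0 ≤ ∫ u, ‖conj u * d u‖ ^ 2 ∂(complexGaussian v) :=
    integral_nonneg fun u => by positivity
  have hB0 : 0 ≤ B := by positivity
  have key : ∀ X : ℝ, 0 ≤ X → 2 * (L ^ 2 * (2 / v * (X + V4))) ≤
      4 * L ^ 2 / v * (1 + V4) * (1 + X) := by
    intro X hX
    have h1 : 2 * ((L : ℝ) ^ 2 * (2 / v * (X + V4))) = 4 * L ^ 2 / v * (X + V4) := by ring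
    rw [h1, mul_assoc]
    refine mul_le_mul_of_nonneg_left ?_ (by positivity)
    nlinarith
  set C1 := 4 * (L : ℝ) ^ 2 / v * (1 + V4) with hC1
  have hC10 : 0 ≤ C1 := by positivity
  refine ⟨C1 + B + s, by positivity, fun N hN z hz η hη hη1 => ?_⟩
  have hX := normDeviation_nonneg v z
  set X := normDeviation v z with hXdef
  have h2 : ∫ V, ‖star z ⬝ᵥ conjTransform (fun w n => d (w n)) z V‖ ^ 2 / sqNorm z
      ∂(haarUnitary N) ≤ (C1 + B + s) * (1 + X) := by
    refine (integral_norm_sq_star_dotProduct_conjTransform_le hN hd hv h0 z).trans ?_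
    have := key X hX
    nlinarith [mul_nonneg hB0 hX, mul_nonneg hs0 hX]
  have h2' : (C1 + B + s) * (1 + X) ≤ (C1 + B + s) / η * (1 + X) := by
    gcongr
    exact le_div_self (by positivity) hη hη1
  refine ⟨?_, h2.trans h2', ?_⟩
  · refine (abs_integral_sqNorm_conjTransform_sub_le hN hd hv z hη).trans (add_le_add ?_ ?_)
    · have h3 : 1 + 1 / η ≤ 2 * (1 / η) := by
        have : 1 ≤ 1 / η := by rwa [le_div_iff₀ hη, one_mul]
        linarith
      calc (1 + 1 / η) * ((L : ℝ) ^ 2 * (2 / v * (X + V4)))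
          ≤ 2 * (1 / η) * ((L : ℝ) ^ 2 * (2 / v * (X + V4))) := by gcongr
        _ = 1 / η * (2 * ((L : ℝ) ^ 2 * (2 / v * (X + V4)))) := by ring
        _ ≤ 1 / η * (C1 * (1 + X)) := by
          refine mul_le_mul_of_nonneg_left (key X hX) (by positivity)
        _ ≤ 1 / η * ((C1 + B + s) * (1 + X)) := by
          gcongr
          linarith
        _ = _ := by ring
    · rw [mul_assoc]
      refine mul_le_mul_of_nonneg_left ?_ hη.le
      rw [mul_comm]
      refine mul_le_mul_of_nonneg_right ?_ (by positivity)
      linarith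
  · refine (integral_norm_star_dotProduct_conjTransform_le (continuous_componentwise hd)
      hz hη).trans (add_le_add le_rfl ?_)
    calc _ ≤ 1 / η * ((C1 + B + s) / η * (1 + X)) :=
          mul_le_mul_of_nonneg_left (h2.trans h2') (by positivity)
      _ = _ := by field_simp

/-! ### Mean information density over Haar transforms -/

section InfoDensity

variable {N : ℕ} {Q : ℂ → ℂ} {K : ℝ≥0}

lemma lipschitzWith_sub_mul (hQ : LipschitzWith K Q) (α : ℂ) :
    LipschitzWith (K + ‖α‖₊) fun u => Q u - α * u :=
  hQ.sub (lipschitzWith_smul α)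

/-- The linear part commutes with V and Vᴴ, which cancel; only the distortion is genuinely rotated.
-/
lemma conjTransform_apply_eq (α : ℂ) (z : Fin N → ℂ) (V : Matrix.unitaryGroup (Fin N) ℂ)
    (k : Fin N) :
    conjTransform (fun w n => Q (w n)) z V k =
      α * z k + conjTransform (fun w n => Q (w n) - α * w n) z V k := by
  have h : (fun w : Fin N → ℂ => fun n => Q (w n) - α * w n) =
      fun w => (fun n => Q (w n)) - α • w := by
    ext w n
    simp
  rw [h]
  unfold conjTransform
  rw [Matrix.mulVec_sub, Matrix.mulVec_smul, mulVec_conjTranspose_mulVec]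
  simp

lemma vectorInfoDensity_conjTransform (α : ℂ) (s : ℝ) (P : Fin N → ℝ) (z : Fin N → ℂ)
    (V : Matrix.unitaryGroup (Fin N) ℂ) :
    vectorInfoDensity α s P (z, conjTransform (fun w n => Q (w n)) z V) =
      -sqNorm (conjTransform (fun w n => Q (w n) - α * w n) z V) / s +
      ∑ k, 1 / (‖α‖ ^ 2 * P k + s) *
        ‖α * z k + conjTransform (fun w n => Q (w n) - α * w n) z V k‖ ^ 2 +
      ∑ k, Real.log (1 + ‖α‖ ^ 2 * P k / s) := by
  unfold vectorInfoDensity gaussianInfoDensity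
  rw [Finset.sum_add_distrib, Finset.sum_add_distrib, sqNorm, ← Finset.sum_neg_distrib,
    Finset.sum_div]
  congr 2
  · refine Finset.sum_congr rfl fun k _ => ?_
    dsimp only
    rw [conjTransform_apply_eq α, add_sub_cancel_left]
  · refine Finset.sum_congr rfl fun k _ => ?_
    dsimp only
    rw [conjTransform_apply_eq α, one_div, inv_mul_eq_div]

/-- The energy bound is applied with weights c_k ≤ 1/s. The effective weight κ of the orthogonal
distortion satisfies |κ| ≤ 1/s, so each departure from the ideal statistics costs at most a multiple
of 1/s. -/
lemma integral_vectorInfoDensity_ge (hN : 2 ≤ N) (hQ : LipschitzWith K Q) (α : ℂ) {s : ℝ}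
    (hs : 0 < s) {P : Fin N → ℝ} (hP : ∀ k, 0 ≤ P k) {z : Fin N → ℂ} (hz : z ≠ 0) :
    ∑ k, Real.log (1 + ‖α‖ ^ 2 * P k / s) - N - 2 + s * ∑ k, 1 / (‖α‖ ^ 2 * P k + s) +
        ‖α‖ ^ 2 * ∑ k, 1 / (‖α‖ ^ 2 * P k + s) * ‖z k‖ ^ 2 -
      1 / s * (2 * |∫ V, sqNorm (conjTransform (fun w n => Q (w n) - α * w n) z V)
          ∂(haarUnitary N) - N * s| +
        2 * ‖α‖ * ∫ V, ‖star z ⬝ᵥ conjTransform (fun w n => Q (w n) - α * w n) z V‖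
          ∂(haarUnitary N) +
        ∫ V, ‖star z ⬝ᵥ conjTransform (fun w n => Q (w n) - α * w n) z V‖ ^ 2 / sqNorm z
          ∂(haarUnitary N)) ≤
    ∫ V, vectorInfoDensity α s P (z, conjTransform (fun w n => Q (w n)) z V) ∂(haarUnitary N) := by
  have hcd : Continuous fun (w : Fin N → ℂ) (n : Fin N) => Q (w n) - α * w n :=
    continuous_componentwise (lipschitzWith_sub_mul hQ α)
  set D := conjTransform (fun w n => Q (w n) - α * w n) z with hD
  have hDc : Continuous D := continuous_conjTransform hcd
  have hSc : Continuous fun V => sqNorm (D V) := continuous_sqNorm.comp hDc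
  have hβc : Continuous fun V => star z ⬝ᵥ D V := (continuous_star_dotProduct _).comp hDc
  have hDk : ∀ k, Continuous fun V => D V k := fun k => (continuous_apply k).comp hDc
  simp_rw [vectorInfoDensity_conjTransform α, ← hD]
  set c : Fin N → ℝ := fun k => 1 / (‖α‖ ^ 2 * P k + s) with hc
  have hden : ∀ k, s ≤ ‖α‖ ^ 2 * P k + s := fun k => by
    have := mul_nonneg (sq_nonneg ‖α‖) (hP k)
    linarith
  have hc0 : ∀ k, 0 ≤ c k := fun k =>
    (one_div_pos.mpr (hs.trans_le (hden k))).le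
  have hcC : ∀ k, c k ≤ 1 / s := fun k => one_div_le_one_div_of_le hs (hden k)
  have hmain := integral_weighted_energy_ge hN hcd hz hc0 hcC α
  rw [← hD] at hmain
  have hi1 : Integrable (fun V => -sqNorm (D V) / s) (haarUnitary N) :=
    integrable_haarUnitary (by fun_prop)
  have hi2 : Integrable (fun V => ∑ k, c k * ‖α * z k + D V k‖ ^ 2) (haarUnitary N) :=
    integrable_haarUnitary (by fun_prop)
  have e1 := integral_add (hi1.add hi2)
    (integrable_const (μ := haarUnitary N) (∑ k, Real.log (1 + ‖α‖ ^ 2 * P k / s)))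
  have e2 := integral_add hi1 hi2
  have e3 : ∫ V, -sqNorm (D V) / s ∂(haarUnitary N) = -(∫ V, sqNorm (D V) ∂(haarUnitary N)) / s := by
    rw [integral_div, integral_neg]
  have e4 : ∫ V, (sqNorm (D V) - ‖star z ⬝ᵥ D V‖ ^ 2 / sqNorm z) ∂(haarUnitary N) =
      ∫ V, sqNorm (D V) ∂(haarUnitary N) -
        ∫ V, ‖star z ⬝ᵥ D V‖ ^ 2 / sqNorm z ∂(haarUnitary N) :=
    integral_sub (integrable_haarUnitary hSc) (integrable_haarUnitary (by fun_prop))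
  rw [e4] at hmain
  refine le_trans ?_ (e1.trans (congrArg (· + _) (e2.trans (congrArg (· + _) e3)))).ge
  simp only [integral_const, probReal_univ, one_smul]
  have hB2 : 0 ≤ ∫ V, ‖star z ⬝ᵥ D V‖ ^ 2 / sqNorm z ∂(haarUnitary N) :=
    integral_nonneg fun V => div_nonneg (by positivity) (sqNorm_nonneg _)
  set A := ∫ V, sqNorm (D V) ∂(haarUnitary N)
  set B1 := ∫ V, ‖star z ⬝ᵥ D V‖ ∂(haarUnitary N)
  set B2 := ∫ V, ‖star z ⬝ᵥ D V‖ ^ 2 / sqNorm z ∂(haarUnitary N)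
  set κ := (∑ k, c k - 1 / s) / ((N : ℝ) - 1) with hκ
  have hN2 : (2 : ℝ) ≤ N := by exact_mod_cast hN
  have hN1 : (0 : ℝ) < N - 1 := by linarith
  have hsum0 : 0 ≤ ∑ k, c k := Finset.sum_nonneg fun k _ => hc0 k
  have hsum1 : ∑ k, c k ≤ N * (1 / s) := by
    refine (Finset.sum_le_sum fun k _ => hcC k).trans ?_
    simp
  have hs1 : 0 < 1 / s := by positivity
  have hκ1 : κ ≤ 1 / s := by
    rw [hκ, div_le_iff₀ hN1]
    linarith
  have hκ2 : -(1 / s) ≤ κ := by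
    rw [hκ, le_div_iff₀ hN1]
    nlinarith
  -- The two units lost come from dimension N - 1 in place of N and from the term removed for the
  -- direction of z: κNs equals s∑c_k - 1 + κs, and κs ≥ -1.
  have hκN : s * ∑ k, c k - 2 ≤ κ * (N * s) := by
    have h1 : κ * (N - 1) = ∑ k, c k - 1 / s := by
      rw [hκ]
      field_simp
    have h2 : κ * (N * s) = s * (∑ k, c k - 1 / s) + κ * s := by
      rw [← h1]
      ring
    have h3 : s * (1 / s) = 1 := by field_simp
    have h4 : -(1 / s) * s ≤ κ * s := mul_le_mul_of_nonneg_right hκ2 hs.le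
    rw [h2]
    linarith
  have hκA : -(1 / s * |A - N * s|) ≤ κ * (A - N * s) := by
    have h1 : |κ * (A - N * s)| ≤ 1 / s * |A - N * s| := by
      rw [abs_mul]
      exact mul_le_mul_of_nonneg_right (abs_le.mpr ⟨hκ2, hκ1⟩) (abs_nonneg _)
    exact (neg_le_neg h1).trans (neg_abs_le _)
  have hκB : κ * B2 ≤ 1 / s * B2 := mul_le_mul_of_nonneg_right hκ1 hB2
  have hA : -A / s ≥ -N - 1 / s * |A - N * s| := by
    have h1 : -A / s = -N - 1 / s * (A - N * s) := by
      field_simp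
      ring
    rw [h1]
    have := mul_le_mul_of_nonneg_left (le_abs_self (A - N * s)) hs1.le
    linarith
  have hfin : 1 / s * (2 * |A - N * s| + 2 * ‖α‖ * B1 + B2) =
      1 / s * |A - N * s| + 1 / s * |A - N * s| + 2 * ‖α‖ * (1 / s) * B1 + 1 / s * B2 := by ring
  rw [hfin]
  have hexp : κ * (A - B2) = κ * (N * s) + κ * (A - N * s) - κ * B2 := by ring
  rw [hexp] at hmain
  linarith

lemma continuous_conjTransform_prod {D : (Fin N → ℂ) → (Fin N → ℂ)} (hD : Continuous D) :
    Continuous fun p : Matrix.unitaryGroup (Fin N) ℂ × (Fin N → ℂ) => conjTransform D p.2 p.1 :=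
  (continuous_coe_unitaryGroup.comp continuous_fst).matrix_mulVec
    (hD.comp continuous_unitary_conjTranspose_mulVec)

/-- Linear growth of Q and unitarity give a bound quadratic in ‖z‖ and independent of V, the
majorant for joint integrability. -/
lemma abs_vectorInfoDensity_conjTransform_le (hQ : LipschitzWith K Q) (α : ℂ) {s : ℝ}
    (hs : 0 < s) {P : Fin N → ℝ} (hP : ∀ k, 0 ≤ P k) (z : Fin N → ℂ)
    (V : Matrix.unitaryGroup (Fin N) ℂ) :
    |vectorInfoDensity α s P (z, conjTransform (fun w n => Q (w n)) z V)| ≤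
      (2 * ‖Q 0 - α * 0‖ ^ 2 * N + 2 * (K + ‖α‖₊ : ℝ≥0) ^ 2 * sqNorm z) / s +
      (2 * ‖Q 0‖ ^ 2 * N + 2 * K ^ 2 * sqNorm z) / s +
      |∑ k, Real.log (1 + ‖α‖ ^ 2 * P k / s)| := by
  have hSV := sqNorm_unitary_conjTranspose_mulVec V z
  have h1 := sqNorm_comp_le (lipschitzWith_sub_mul hQ α) ((V : Matrix (Fin N) (Fin N) ℂ)ᴴ *ᵥ z)
  have h2 := sqNorm_comp_le hQ ((V : Matrix (Fin N) (Fin N) ℂ)ᴴ *ᵥ z)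
  rw [hSV] at h1 h2
  have h1' : sqNorm (conjTransform (fun w n => Q (w n) - α * w n) z V) ≤ _ :=
    (sqNorm_conjTransform _ _ _).le.trans h1
  have h2' : sqNorm (conjTransform (fun w n => Q (w n)) z V) ≤ _ :=
    (sqNorm_conjTransform _ _ _).le.trans h2
  rw [vectorInfoDensity_conjTransform α]
  refine (abs_add_le _ _).trans (add_le_add ((abs_add_le _ _).trans (add_le_add ?_ ?_)) le_rfl)
  · rw [abs_div, abs_neg, abs_of_nonneg (sqNorm_nonneg _), abs_of_pos hs]
    exact div_le_div_of_nonneg_right h1' hs.le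
  · have hden : ∀ k, s ≤ ‖α‖ ^ 2 * P k + s := fun k => by
      have := mul_nonneg (sq_nonneg ‖α‖) (hP k)
      linarith
    rw [abs_of_nonneg (Finset.sum_nonneg fun k _ =>
      mul_nonneg (one_div_pos.mpr (hs.trans_le (hden k))).le (sq_nonneg _))]
    refine le_trans ?_ (div_le_div_of_nonneg_right h2' hs.le)
    rw [div_eq_inv_mul, sqNorm, Finset.mul_sum, ← one_div]
    refine Finset.sum_le_sum fun k _ => ?_
    rw [conjTransform_apply_eq α]
    exact mul_le_mul_of_nonneg_right (one_div_le_one_div_of_le hs (hden k)) (by positivity)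

lemma integrable_vectorInfoDensity_conjTransform (hQ : LipschitzWith K Q) (α : ℂ) {s : ℝ}
    (hs : 0 < s) {P : Fin N → ℝ} (hP : ∀ k, 0 ≤ P k) :
    Integrable (fun p : Matrix.unitaryGroup (Fin N) ℂ × (Fin N → ℂ) =>
      vectorInfoDensity α s P (p.2, conjTransform (fun w n => Q (w n)) p.2 p.1))
      ((haarUnitary N).prod (Measure.pi fun k => complexGaussian (P k))) := by
  have hc : Continuous (fun p : Matrix.unitaryGroup (Fin N) ℂ × (Fin N → ℂ) =>
      vectorInfoDensity α s P (p.2, conjTransform (fun w n => Q (w n)) p.2 p.1)) :=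
    (continuous_vectorInfoDensity α s P).comp (continuous_snd.prodMk
      (continuous_conjTransform_prod (continuous_componentwise hQ)))
  have hS := (integrable_sqNorm P).comp_snd (haarUnitary N)
  refine Integrable.mono' (((((integrable_const (2 * ‖Q 0 - α * 0‖ ^ 2 * N)).add
      (hS.const_mul (2 * (K + ‖α‖₊ : ℝ≥0) ^ 2))).div_const s).add
    (((integrable_const (2 * ‖Q 0‖ ^ 2 * N)).add (hS.const_mul (2 * K ^ 2))).div_const s)).add
    (integrable_const |∑ k, Real.log (1 + ‖α‖ ^ 2 * P k / s)|)) hc.aestronglyMeasurable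
    (ae_of_all _ fun p => ?_)
  exact abs_vectorInfoDensity_conjTransform_le hQ α hs hP p.2 p.1

end InfoDensity

/-! ### Averaging over the Gaussian symbols -/

/-- Bussgang decomposition: αu is the orthogonal projection of Q(u) onto the multiples of u in L² of
the Gaussian law. -/
lemma integral_conj_mul_distortion_eq_zero {Q : ℂ → ℂ} {K : ℝ≥0} (hQ : LipschitzWith K Q) {v : ℝ}
    (hv : 0 < v) : ∫ u, conj u * (Q u - alphaTx Q v * u) ∂(complexGaussian v) = 0 := by
  have h1 := (memLp_conj_mul_lipschitz hQ v).integrable (by norm_num)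
  have h2 := (memLp_conj_mul_lipschitz (LipschitzWith.id (α := ℂ)) v).integrable (by norm_num)
  have e : ∀ u, conj u * (Q u - alphaTx Q v * u) =
      conj u * Q u - alphaTx Q v * (conj u * id u) := fun u => by
    simp only [id]
    ring
  have h3 : ∫ u, conj u * id u ∂(complexGaussian v) = (v : ℂ) := by
    conv_rhs => rw [← integral_norm_sq_complexGaussian hv.le]
    rw [← integral_complex_ofReal]
    refine integral_congr_ae (ae_of_all _ fun u => ?_)
    simp [Complex.conj_mul']
  simp_rw [e]
  rw [integral_sub h1 (h2.const_mul _), integral_const_mul, h3, alphaTx, div_mul_cancel₀, sub_self]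
  exact_mod_cast hv.ne'

lemma integrable_normDeviation {N : ℕ} (P : Fin N → ℝ) (v : ℝ) :
    Integrable (fun z : Fin N → ℂ => normDeviation v z)
      (Measure.pi fun k => complexGaussian (P k)) :=
  (integrable_sqNorm_sub_sq P _).div_const _

/-- Independence bounds the variance of ‖z‖² by NW, so division by N leaves a constant. What remains
is the deterministic error of the average power. -/
lemma integral_normDeviation_le {N : ℕ} {P : Fin N → ℝ} (hP : ∀ k, 0 ≤ P k) (v : ℝ)
    {W : ℝ} (hW : ∀ k, ∫ u, (‖u‖ ^ 2 - P k) ^ 2 ∂(complexGaussian (P k)) ≤ W) (hW0 : 0 ≤ W) :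
    ∫ z, normDeviation v z ∂(Measure.pi fun k => complexGaussian (P k)) ≤
      2 * W + 2 * ((∑ k, P k - N * v) ^ 2 / N) := by
  have h1 : ∀ z : Fin N → ℂ, normDeviation v z ≤
      2 / N * (sqNorm z - ∑ k, P k) ^ 2 + 2 * ((∑ k, P k - N * v) ^ 2 / N) := by
    intro z
    have h2 : 2 / N * (sqNorm z - ∑ k, P k) ^ 2 + 2 * ((∑ k, P k - N * v) ^ 2 / N) =
        (2 * (sqNorm z - ∑ k, P k) ^ 2 + 2 * (∑ k, P k - N * v) ^ 2) / N := by ring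
    rw [h2, normDeviation]
    refine div_le_div_of_nonneg_right ?_ (by positivity)
    nlinarith [sq_nonneg ((sqNorm z - ∑ k, P k) - (∑ k, P k - N * v))]
  have hi := integrable_sqNorm_sub_sq P (∑ k, P k)
  refine (integral_mono (integrable_normDeviation P v)
    ((hi.const_mul _).add (integrable_const _)) h1).trans ?_
  simp only [Pi.add_apply]
  rw [integral_add (hi.const_mul _) (integrable_const _), integral_const_mul,
    integral_sqNorm_sub_sq hP]
  simp only [integral_const, probReal_univ, one_smul]
  refine add_le_add ?_ le_rfl
  have h3 : ∑ k, ∫ u, (‖u‖ ^ 2 - P k) ^ 2 ∂(complexGaussian (P k)) ≤ N * W := by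
    refine (Finset.sum_le_sum fun k _ => hW k).trans ?_
    simp
  rcases Nat.eq_zero_or_pos N with h0 | hN
  · subst h0
    simpa using hW0
  · calc _ ≤ 2 / (N : ℝ) * (N * W) := mul_le_mul_of_nonneg_left h3 (by positivity)
      _ = 2 * W := by
        have : (N : ℝ) ≠ 0 := by positivity
        field_simp

/-- Lower bound, uniform in the dimension, for the expected information density of the ensemble of
random transforms. -/
theorem exists_integral_vectorInfoDensity_ge {Q : ℂ → ℂ} {K : ℝ≥0} (hQ : LipschitzWith K Q)
    {v : ℝ} (hv : 0 < v) {s : ℝ} (hs : 0 < s)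
    (hsQ : s = ∫ u, ‖Q u - alphaTx Q v * u‖ ^ 2 ∂(complexGaussian v)) {M : ℕ} {p : Fin M → ℝ}
    (hp : ∀ m, 0 ≤ p m) :
    ∃ C : ℝ, 0 ≤ C ∧ ∀ N : ℕ, 2 ≤ N → ∀ a : Fin N → Fin M, 0 < ∑ k, p (a k) →
      ∀ η : ℝ, 0 < η → η ≤ 1 →
      ∑ k, Real.log (1 + ‖alphaTx Q v‖ ^ 2 * p (a k) / s) -
          C / η ^ 2 * (1 + (∑ k, p (a k) - N * v) ^ 2 / N) - η * C * N ≤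
        ∫ q, vectorInfoDensity (alphaTx Q v) s (fun k => p (a k))
            (q.2, conjTransform (fun w n => Q (w n)) q.2 q.1)
          ∂((haarUnitary N).prod (Measure.pi fun k => complexGaussian (p (a k)))) := by
  set α := alphaTx Q v with hα
  obtain ⟨C, hC0, hC⟩ := exists_distortion_bounds (lipschitzWith_sub_mul hQ α) hv
    (integral_conj_mul_distortion_eq_zero hQ hv)
  -- Only finitely many powers occur, so one constant bounds the variance of every |z_k|², for all N
  -- and all assignments a.
  set W := ∑ m, ∫ u, (‖u‖ ^ 2 - p m) ^ 2 ∂(complexGaussian (p m)) with hW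
  have hW0' : ∀ m, 0 ≤ ∫ u, (‖u‖ ^ 2 - p m) ^ 2 ∂(complexGaussian (p m)) :=
    fun m => integral_nonneg fun u => by positivity
  have hW0 : 0 ≤ W := Finset.sum_nonneg fun m _ => hW0' m
  set pm := ∑ m, p m with hpm
  have hpm0 : 0 ≤ pm := Finset.sum_nonneg fun m _ => hp m
  set E := 1 / s * (3 * C + 2 * ‖α‖ * C) with hE
  have hE0 : 0 ≤ E := by positivity
  refine ⟨2 + E * (2 + 2 * W) + 1 / s * (2 * C + 2 * ‖α‖ * pm), by positivity,
    fun N hN a hpos η hη hη1 => ?_⟩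
  set P : Fin N → ℝ := fun k => p (a k) with hPdef
  have hP : ∀ k, 0 ≤ P k := fun k => hp _
  set R := (∑ k, P k - N * v) ^ 2 / (N : ℝ) with hR
  have hR0 : 0 ≤ R := by positivity
  set pz := Measure.pi fun k => complexGaussian (P k) with hpz
  have hint := integrable_vectorInfoDensity_conjTransform hQ α hs hP
  rw [integral_prod_symm _ hint]
  obtain ⟨k0, -, hk0⟩ : ∃ k ∈ Finset.univ, 0 < P k := by
    by_contra! h
    exact absurd hpos (not_lt.mpr (Finset.sum_nonpos h))
  have hae : ∀ᵐ z ∂pz, z ≠ 0 := ae_pi_complexGaussian_ne_zero hk0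
  set ℓ := ∑ k, Real.log (1 + ‖α‖ ^ 2 * P k / s) with hℓ
  set c : Fin N → ℝ := fun k => 1 / (‖α‖ ^ 2 * P k + s) with hc
  set lower : (Fin N → ℂ) → ℝ := fun z =>
    (ℓ - N - 2 + s * ∑ k, c k - 1 / s * (2 * η * C * N)) +
      (‖α‖ ^ 2 * ∑ k, c k * ‖z k‖ ^ 2 - (E / η ^ 2 * (1 + normDeviation v z) +
        1 / s * (2 * ‖α‖ * η) * sqNorm z)) with hlower
  have hlow : ∀ᵐ z ∂pz, lower z ≤
      ∫ V, vectorInfoDensity α s P (z, conjTransform (fun w n => Q (w n)) z V)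
        ∂(haarUnitary N) := by
    filter_upwards [hae] with z hz
    refine le_trans ?_ (integral_vectorInfoDensity_ge hN hQ α hs hP hz)
    obtain ⟨h1, h2, h3⟩ := hC N (by omega) z hz η hη hη1
    rw [← hsQ] at h1
    have hX := normDeviation_nonneg v z
    set X := normDeviation v z
    have hηη : C / η ≤ C / η ^ 2 := by
      apply div_le_div_of_nonneg_left hC0 (by positivity)
      nlinarith
    have h4 : C / η * (1 + X) ≤ C / η ^ 2 * (1 + X) :=
      mul_le_mul_of_nonneg_right hηη (by positivity)
    have h5 : 2 * |∫ V, sqNorm (conjTransform (fun w n => Q (w n) - α * w n) z V)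
          ∂(haarUnitary N) - N * s| +
        2 * ‖α‖ * ∫ V, ‖star z ⬝ᵥ conjTransform (fun w n => Q (w n) - α * w n) z V‖
          ∂(haarUnitary N) +
        ∫ V, ‖star z ⬝ᵥ conjTransform (fun w n => Q (w n) - α * w n) z V‖ ^ 2 / sqNorm z
          ∂(haarUnitary N) ≤
        (3 * C + 2 * ‖α‖ * C) / η ^ 2 * (1 + X) + 2 * η * C * N + 2 * ‖α‖ * η * sqNorm z := by
      have h6 := mul_le_mul_of_nonneg_left h3 (by positivity : 0 ≤ 2 * ‖α‖)
      have h7 : (3 * C + 2 * ‖α‖ * C) / η ^ 2 * (1 + X) =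
        3 * (C / η ^ 2 * (1 + X)) + 2 * ‖α‖ * (C / η ^ 2 * (1 + X)) := by ring
      rw [h7]
      linarith
    have h8 := mul_le_mul_of_nonneg_left h5 (by positivity : 0 ≤ 1 / s)
    have h9 : 1 / s * ((3 * C + 2 * ‖α‖ * C) / η ^ 2 * (1 + X) + 2 * η * C * N +
        2 * ‖α‖ * η * sqNorm z) = E / η ^ 2 * (1 + X) + 1 / s * (2 * η * C * N) +
          1 / s * (2 * ‖α‖ * η) * sqNorm z := by
      rw [hE]
      ring
    rw [h9] at h8
    simp only [hlower]
    linarith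
  have hi1 : Integrable (fun z : Fin N → ℂ => ‖α‖ ^ 2 * ∑ k, c k * ‖z k‖ ^ 2) pz :=
    (integrable_finsetSum _ fun k _ => (integrable_norm_sq_eval P k).const_mul _).const_mul _
  have hi2 : Integrable (fun z : Fin N → ℂ => E / η ^ 2 * (1 + normDeviation v z)) pz :=
    ((integrable_const _).add (integrable_normDeviation P v)).const_mul _
  have hi3 : Integrable (fun z : Fin N → ℂ => 1 / s * (2 * ‖α‖ * η) * sqNorm z) pz :=
    (integrable_sqNorm P).const_mul _
  have hi23 : Integrable (fun z : Fin N → ℂ => E / η ^ 2 * (1 + normDeviation v z) +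
      1 / s * (2 * ‖α‖ * η) * sqNorm z) pz := hi2.add hi3
  have hi123 : Integrable (fun z : Fin N → ℂ => ‖α‖ ^ 2 * ∑ k, c k * ‖z k‖ ^ 2 -
      (E / η ^ 2 * (1 + normDeviation v z) + 1 / s * (2 * ‖α‖ * η) * sqNorm z)) pz :=
    hi1.sub hi23
  have hi : Integrable lower pz := (integrable_const _).add hi123
  refine le_trans ?_ (integral_mono_ae hi hint.integral_prod_right hlow)
  have elow : ∫ z, lower z ∂pz =
      (ℓ - N - 2 + s * ∑ k, c k - 1 / s * (2 * η * C * N)) +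
      (‖α‖ ^ 2 * ∑ k, c k * P k - (E / η ^ 2 * (1 + ∫ z, normDeviation v z ∂pz) +
        1 / s * (2 * ‖α‖ * η) * ∑ k, P k)) := by
    have q1 : ∫ z : Fin N → ℂ, ‖α‖ ^ 2 * ∑ k, c k * ‖z k‖ ^ 2 ∂pz = ‖α‖ ^ 2 * ∑ k, c k * P k := by
      rw [integral_const_mul,
        integral_finsetSum _ fun k _ => (integrable_norm_sq_eval P k).const_mul _]
      refine congrArg _ (Finset.sum_congr rfl fun k _ => ?_)
      rw [integral_const_mul]
      exact congrArg _ (integral_norm_sq_eval hP k)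
    have q2 : ∫ z : Fin N → ℂ, E / η ^ 2 * (1 + normDeviation v z) ∂pz =
        E / η ^ 2 * (1 + ∫ z, normDeviation v z ∂pz) := by
      rw [integral_const_mul, integral_add (integrable_const _) (integrable_normDeviation P v),
        integral_const, probReal_univ, one_smul]
    have q3 : ∫ z : Fin N → ℂ, 1 / s * (2 * ‖α‖ * η) * sqNorm z ∂pz =
        1 / s * (2 * ‖α‖ * η) * ∑ k, P k := by
      rw [integral_const_mul, integral_sqNorm hP]
    rw [hlower, integral_add (integrable_const _) hi123, integral_sub hi1 hi23,
      integral_add hi2 hi3, q1, q2, q3, integral_const, probReal_univ, one_smul]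
  -- Exact cancellation: each coordinate contributes c_k (s + |α|²P_k) = 1, which compensates the -N
  -- from the distortion energy and leaves only the logarithms.
  have hcs : s * ∑ k, c k + ‖α‖ ^ 2 * ∑ k, c k * P k = N := by
    rw [Finset.mul_sum, Finset.mul_sum, ← Finset.sum_add_distrib]
    have : ∀ k, s * c k + ‖α‖ ^ 2 * (c k * P k) = 1 := fun k => by
      have h1 : 0 < ‖α‖ ^ 2 * P k + s := by have := hP k; positivity
      simp only [hc]
      field_simp
      ring
    simp [this]
  have hX := integral_normDeviation_le hP v (W := W) (fun k =>
    Finset.single_le_sum (f := fun m => ∫ u, (‖u‖ ^ 2 - p m) ^ 2 ∂(complexGaussian (p m))) (fun m _ => hW0' m) (Finset.mem_univ (a k))) hW0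
  have hSP : ∑ k, P k ≤ N * pm := by
    have h1 : ∀ k ∈ Finset.univ, P k ≤ pm := fun k _ =>
      Finset.single_le_sum (f := p) (fun m _ => hp m) (Finset.mem_univ (a k))
    refine (Finset.sum_le_sum h1).trans ?_
    simp
  rw [elow]
  have h1 : E / η ^ 2 * (1 + ∫ z, normDeviation v z ∂pz) ≤
      E * (2 + 2 * W) / η ^ 2 * (1 + R) := by
    have h0 : E * (2 + 2 * W) / η ^ 2 * (1 + R) = E / η ^ 2 * ((2 + 2 * W) * (1 + R)) := by ring
    rw [h0]
    refine mul_le_mul_of_nonneg_left ?_ (by positivity)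
    nlinarith [mul_nonneg hW0 hR0]
  have h2 : 1 / s * (2 * ‖α‖ * η) * ∑ k, P k ≤ η * (1 / s * (2 * ‖α‖ * pm)) * N := by
    refine (mul_le_mul_of_nonneg_left hSP (by positivity)).trans (le_of_eq ?_)
    ring
  have h3 : (2 : ℝ) ≤ 2 / η ^ 2 * (1 + R) := by
    have h4 : 2 ≤ 2 / η ^ 2 := by
      rw [le_div_iff₀ (by positivity)]
      nlinarith
    nlinarith [mul_nonneg (by positivity : 0 ≤ 2 / η ^ 2) hR0]
  have h5 : (2 + E * (2 + 2 * W) + 1 / s * (2 * C + 2 * ‖α‖ * pm)) / η ^ 2 * (1 + R) =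
      2 / η ^ 2 * (1 + R) + E * (2 + 2 * W) / η ^ 2 * (1 + R) +
        1 / s * (2 * C + 2 * ‖α‖ * pm) / η ^ 2 * (1 + R) := by ring
  have h6 : 0 ≤ 1 / s * (2 * C + 2 * ‖α‖ * pm) / η ^ 2 * (1 + R) := by positivity
  have h7 : η * (2 + E * (2 + 2 * W) + 1 / s * (2 * C + 2 * ‖α‖ * pm)) * N =
      η * (2 + E * (2 + 2 * W)) * N + 1 / s * (2 * η * C * N) +
        η * (1 / s * (2 * ‖α‖ * pm)) * N := by ring
  have h8 : 0 ≤ η * (2 + E * (2 + 2 * W)) * N := by positivity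
  rw [h5, h7]
  linarith

/-! ### From finite dimension to the ensemble rate -/

/-- The clipping in `ENNReal.ofReal` loses nothing, since L is at most its positive part; comparison
in `EReal` admits negative L and infinite rates. -/
lemma le_asymptoticRate {I : ℕ → ℝ≥0∞} {L : ℝ}
    (h : ∀ ε : ℝ, 0 < ε → ∀ᶠ N : ℕ in atTop, ENNReal.ofReal (N * (L - ε)) ≤ I N) :
    (L : EReal) ≤ (asymptoticRate I : ℝ≥0∞) := by
  have h1 : ∀ ε : ℝ, 0 < ε → ENNReal.ofReal (L - ε) ≤ asymptoticRate I := by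
    intro ε hε
    refine le_liminf_of_le (by isBoundedDefault) ?_
    filter_upwards [h ε hε, eventually_gt_atTop 0] with N hN hN0
    rw [ENNReal.le_div_iff_mul_le (Or.inl (by exact_mod_cast hN0.ne'))
      (Or.inl (ENNReal.natCast_ne_top N)), mul_comm, ← ENNReal.ofReal_natCast,
      ← ENNReal.ofReal_mul (Nat.cast_nonneg N)]
    exact hN
  have h2 : ENNReal.ofReal L ≤ asymptoticRate I := by
    have ht : Tendsto (fun ε : ℝ => ENNReal.ofReal (L - ε)) (𝓝[>] 0) (𝓝 (ENNReal.ofReal L)) := by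
      have hc : Continuous fun ε : ℝ => ENNReal.ofReal (L - ε) :=
        ENNReal.continuous_ofReal.comp (by fun_prop)
      have := (hc.tendsto 0).mono_left (nhdsWithin_le_nhds (s := Set.Ioi 0))
      simpa using this
    exact le_of_tendsto ht (eventually_nhdsWithin_of_forall fun ε hε => h1 ε hε)
  have h3 : (L : EReal) ≤ (ENNReal.ofReal L : EReal) := by
    rw [EReal.coe_ennreal_ofReal]
    exact_mod_cast le_max_left L 0
  exact h3.trans (by exact_mod_cast h2)

lemma mutualInfo_congr_right {Ω α β : Type*} [MeasurableSpace Ω] [MeasurableSpace α]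
    [MeasurableSpace β] {μ : Measure Ω} {X : Ω → α} {Y Y' : Ω → β} (h : Y =ᵐ[μ] Y') :
    mutualInfo μ X Y = mutualInfo μ X Y' := by
  have h2 : (fun ω => (X ω, Y ω)) =ᵐ[μ] fun ω => (X ω, Y' ω) := by
    filter_upwards [h] with ω hω
    rw [hω]
  rw [mutualInfo, mutualInfo, Measure.map_congr h, Measure.map_congr h2]

lemma ae_complexGaussian_zero : ∀ᵐ u ∂(complexGaussian 0), u = 0 := by
  rw [complexGaussian, zero_div, Real.toNNReal_zero, gaussianReal_zero_var, Measure.dirac_prod_dirac,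
    Measure.map_dirac' Complex.measurableEquivRealProd.symm.measurable, ae_dirac_eq]
  exact Complex.ext rfl rfl

/-- The law `CN(0, 0)` is a point mass, so the noise can be erased from the channel almost surely,
without changing the mutual information. -/
lemma ae_eq_zero_of_hasLaw_complexGaussian_zero {Ω : Type*} [MeasurableSpace Ω] {μ : Measure Ω}
    {N : ℕ} {ξ : Ω → Fin N → ℂ} (hξ : HasLaw ξ (Measure.pi fun _ => complexGaussian 0) μ) :
    ∀ᵐ ω ∂μ, ξ ω = 0 := by
  rw [hξ.ae_iff (p := fun w => w = 0) (measurableSet_singleton 0).mem]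
  have h : ∀ k : Fin N, ∀ᵐ w ∂(Measure.pi fun _ : Fin N => complexGaussian 0), w k = 0 :=
    fun k => (measurePreserving_eval (fun _ : Fin N => complexGaussian 0)
      k).quasiMeasurePreserving.ae ae_complexGaussian_zero
  filter_upwards [ae_all_iff.mpr h] with w hw
  exact funext hw

lemma receivedSymbols_zero_noise {N : ℕ} (Q : ℂ → ℂ) (V : Matrix.unitaryGroup (Fin N) ℂ)
    (z : Fin N → ℂ) :
    receivedSymbols Q (fun x w => x + w) id V z 0 = conjTransform (fun w n => Q (w n)) z V := by
  simp [receivedSymbols, conjTransform]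

lemma sum_comp_eq_sum_card_mul {N M : ℕ} (a : Fin N → Fin M) (f : Fin M → ℝ) :
    ∑ k, f (a k) = ∑ m, (Nat.card {k : Fin N // a k = m} : ℝ) * f m := by
  rw [← Finset.sum_fiberwise_of_maps_to (t := Finset.univ) (g := a) fun _ _ => Finset.mem_univ _]
  refine Finset.sum_congr rfl fun m _ => ?_
  rw [Finset.sum_congr rfl (g := fun _ => f m), Finset.sum_const, nsmul_eq_mul,
    Nat.card_eq_fintype_card, Fintype.card_subtype]
  intro k hk
  rw [(Finset.mem_filter.mp hk).2]

lemma tendsto_sum_comp_div {M : ℕ} {a : ∀ N : ℕ, Fin N → Fin M} {δ : Fin M → ℝ}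
    (hδ : ∀ m, Tendsto (fun N : ℕ => (Nat.card {k : Fin N // a N k = m} : ℝ) / (N : ℝ))
      atTop (𝓝 (δ m))) (f : Fin M → ℝ) :
    Tendsto (fun N : ℕ => (∑ k, f (a N k)) / (N : ℝ)) atTop (𝓝 (∑ m, δ m * f m)) := by
  have h := tendsto_finsetSum Finset.univ fun m _ => (hδ m).mul_const (f m)
  refine h.congr fun N => ?_
  rw [sum_comp_eq_sum_card_mul, Finset.sum_div]
  exact Finset.sum_congr rfl fun m _ => by ring

set_option maxHeartbeats 2000000 in
/-- The linear rate of the ensemble of Haar-distributed transforms at zero noise. -/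
theorem le_asymptoticRate_ensemble
    {Ω : Type*} [MeasurableSpace Ω] (μ : Measure Ω) [IsProbabilityMeasure μ]
    {M : ℕ} (a : ∀ N : ℕ, Fin N → Fin M) (δ : Fin M → ℝ)
    (hδ : ∀ m, Tendsto (fun N : ℕ => (Nat.card {k : Fin N // a N k = m} : ℝ) / (N : ℝ))
      atTop (𝓝 (δ m)))
    (P : Fin M → ℝ) (hP : ∀ m, 0 ≤ P m)
    (v : ℝ) (hv : v = ∑ m, δ m * P m) (hv0 : 0 < v)
    (Q : ℂ → ℂ) (K : ℝ≥0) (hQ : LipschitzWith K Q) (s : ℝ) (hs : 0 < s)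
    (hsQ : s = ∫ u, ‖Q u - alphaTx Q v * u‖ ^ 2 ∂(complexGaussian v))
    (V : ∀ N : ℕ, Ω → Matrix.unitaryGroup (Fin N) ℂ) (z : ∀ N : ℕ, Ω → Fin N → ℂ)
    (hVz : ∀ N, HasLaw (fun ω => (V N ω, z N ω))
      ((haarUnitary N).prod (Measure.pi fun k => complexGaussian (P (a N k)))) μ) :
    ((∑ m, δ m * Real.log (1 + ‖alphaTx Q v‖ ^ 2 * P m / s) : ℝ) : EReal) ≤
      (asymptoticRate fun N => mutualInfo μ (z N) fun ω =>
        conjTransform (fun w n => Q (w n)) (z N ω) (V N ω) : ℝ≥0∞) := by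
  set α := alphaTx Q v with hα
  obtain ⟨C, hC0, hC⟩ := exists_integral_vectorInfoDensity_ge hQ hv0 hs hsQ hP
  rw [← hα] at hC
  set L := ∑ m, δ m * Real.log (1 + ‖α‖ ^ 2 * P m / s) with hL
  have hPlim := tendsto_sum_comp_div hδ P
  rw [← hv] at hPlim
  have hLlim := tendsto_sum_comp_div hδ fun m => Real.log (1 + ‖α‖ ^ 2 * P m / s)
  rw [← hL] at hLlim
  refine le_asymptoticRate fun ε hε => ?_
  -- η is fixed before N grows: ηC takes half of ε, and the remaining error C/η² · (1/N + (average
  -- power - v)²) tends to zero for this η.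
  obtain ⟨η, hη, hη1, hηC⟩ : ∃ η : ℝ, 0 < η ∧ η ≤ 1 ∧ η * C ≤ ε / 2 := by
    refine ⟨min 1 (ε / (2 * (C + 1))), by positivity, min_le_left _ _, ?_⟩
    calc min 1 (ε / (2 * (C + 1))) * C ≤ ε / (2 * (C + 1)) * C :=
          mul_le_mul_of_nonneg_right (min_le_right _ _) hC0
      _ ≤ ε / (2 * (C + 1)) * (C + 1) := by gcongr; linarith
      _ = ε / 2 := by field_simp
  have hlim : Tendsto (fun N : ℕ =>
      (∑ k, Real.log (1 + ‖α‖ ^ 2 * P (a N k) / s)) / (N : ℝ) -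
        C / η ^ 2 * (1 / (N : ℝ) + ((∑ k, P (a N k)) / (N : ℝ) - v) ^ 2) - η * C) atTop
      (𝓝 (L - C / η ^ 2 * (0 + (v - v) ^ 2) - η * C)) :=
    (hLlim.sub ((tendsto_one_div_atTop_nhds_zero_nat.add
      ((hPlim.sub_const v).pow 2)).const_mul _)).sub_const _
  have hlt : L - ε < L - C / η ^ 2 * (0 + (v - v) ^ 2) - η * C := by
    rw [sub_self, zero_pow two_ne_zero, add_zero, mul_zero]
    linarith
  filter_upwards [hlim.eventually_const_lt hlt, hPlim.eventually_const_lt hv0,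
    eventually_ge_atTop 2] with N h1 h2 hN
  have hN0 : (0 : ℝ) < N := by
    have : (2 : ℝ) ≤ N := by exact_mod_cast hN
    linarith
  have hpos : 0 < ∑ k, P (a N k) := by
    have := mul_pos h2 hN0
    rwa [div_mul_cancel₀ _ hN0.ne'] at this
  have hP' : ∀ k, 0 ≤ P (a N k) := fun k => hP _
  have hint := integrable_vectorInfoDensity_conjTransform hQ α hs hP'
  have hz : HasLaw (z N) (Measure.pi fun k => complexGaussian (P (a N k))) μ := by
    have := (measurePreserving_snd (μ := haarUnitary N)
      (ν := Measure.pi fun k => complexGaussian (P (a N k)))).hasLaw.comp (hVz N)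
    exact this
  have hcY : Continuous fun p : Matrix.unitaryGroup (Fin N) ℂ × (Fin N → ℂ) =>
      conjTransform (fun w n => Q (w n)) p.2 p.1 :=
    continuous_conjTransform_prod (continuous_componentwise hQ)
  have hY : AEMeasurable (fun ω => conjTransform (fun w n => Q (w n)) (z N ω) (V N ω)) μ :=
    hcY.measurable.comp_aemeasurable (hVz N).aemeasurable
  have hmap := (hVz N).map_eq
  have hint' : Integrable (fun ω => vectorInfoDensity α s (fun k => P (a N k))
      (z N ω, conjTransform (fun w n => Q (w n)) (z N ω) (V N ω))) μ := by
    rw [← hmap] at hint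
    exact hint.comp_aemeasurable (hVz N).aemeasurable
  have heq := (hVz N).integral_comp hint.aestronglyMeasurable
  have hmi := ofReal_integral_vectorInfoDensity_le_mutualInfo α hs hP' hz hY hint'
  refine le_trans (ENNReal.ofReal_le_ofReal ?_) hmi
  refine le_trans ?_ ((hC N hN (a N) hpos η hη hη1).trans heq.ge)
  have h3 := mul_le_mul_of_nonneg_left h1.le hN0.le
  refine h3.trans (le_of_eq ?_)
  field_simp

/-! ### Infinite mutual information of a noiseless fixed channel -/

/-- A Lipschitz map sends the exceptional null set to a null set, so the whole range is null; being
an interval, it is then a single point. -/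
lemma lipschitz_real_const_of_ae_mem_countable {f : ℝ → ℝ} {L : ℝ≥0} (hf : LipschitzWith L f)
    {A : Set ℝ} (hA : A.Countable) (h : ∀ᵐ t, f t ∈ A) (t : ℝ) : f t = f 0 := by
  have hnull : volume (f '' {t | f t ∉ A}) = 0 := by
    have h1 := hf.hausdorffMeasure_image_le zero_le_one {t | f t ∉ A}
    rw [hausdorffMeasure_real] at h1
    have h2 : volume {t | f t ∉ A} = 0 := h
    rw [h2, mul_zero] at h1
    exact le_antisymm h1 zero_le
  have hrange : volume (Set.range f) = 0 := by
    refine measure_mono_null (t := A ∪ f '' {t | f t ∉ A}) ?_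
      (measure_union_null (hA.measure_zero _) hnull)
    rintro _ ⟨x, rfl⟩
    by_cases hx : f x ∈ A
    · exact Or.inl hx
    · exact Or.inr ⟨x, hx, rfl⟩
  by_contra hne
  have hsub : Set.uIcc (f t) (f 0) ⊆ Set.range f :=
    (isPreconnected_range hf.continuous).ordConnected.uIcc_subset ⟨t, rfl⟩ ⟨0, rfl⟩
  have h3 := measure_mono_null hsub hrange
  rw [Set.uIcc, Real.volume_Icc, ENNReal.ofReal_eq_zero, sub_nonpos] at h3
  exact absurd h3 (not_le.mpr (inf_lt_sup.mpr hne))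

lemma lipschitz_line_const_of_ae_mem_countable {f : ℝ → ℂ} {L : ℝ≥0} (hf : LipschitzWith L f)
    {A : Set ℂ} (hA : A.Countable) (h : ∀ᵐ t, f t ∈ A) (t : ℝ) : f t = f 0 := by
  have hre : LipschitzWith L fun t => (f t).re :=
    LipschitzWith.of_dist_le_mul fun x y => by
      refine le_trans ?_ (hf.dist_le_mul x y)
      rw [Real.dist_eq, Complex.dist_eq, ← Complex.sub_re]
      exact Complex.abs_re_le_norm _
  have him : LipschitzWith L fun t => (f t).im :=
    LipschitzWith.of_dist_le_mul fun x y => by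
      refine le_trans ?_ (hf.dist_le_mul x y)
      rw [Real.dist_eq, Complex.dist_eq, ← Complex.sub_im]
      exact Complex.abs_im_le_norm _
  refine Complex.ext ?_ ?_
  · exact lipschitz_real_const_of_ae_mem_countable hre (hA.image Complex.re)
      (h.mono fun t ht => ⟨f t, ht, rfl⟩) t
  · exact lipschitz_real_const_of_ae_mem_countable him (hA.image Complex.im)
      (h.mono fun t ht => ⟨f t, ht, rfl⟩) t

/-- A Lipschitz function on the plane with almost all values in a countable set is constant. -/
lemma lipschitz_const_of_ae_mem_countable {Q : ℂ → ℂ} {K : ℝ≥0} (hQ : LipschitzWith K Q)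
    {A : Set ℂ} (hA : A.Countable) (h : ∀ᵐ u, Q u ∈ A) (u : ℂ) : Q u = Q 0 := by
  have hprod : ∀ᵐ p : ℝ × ℝ, Q ⟨p.1, p.2⟩ ∈ A :=
    Complex.volume_preserving_equiv_real_prod.symm.quasiMeasurePreserving.ae h
  have hvert : ∀ x y : ℝ, Q ⟨x, y⟩ = Q ⟨x, 0⟩ := by
    have h1 : ∀ᵐ x : ℝ, ∀ᵐ y : ℝ, Q ⟨x, y⟩ ∈ A := Measure.ae_ae_of_ae_prod hprod
    have h2 : ∀ᵐ x : ℝ, ∀ y : ℝ, Q ⟨x, y⟩ = Q ⟨x, 0⟩ := by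
      filter_upwards [h1] with x hx y
      refine lipschitz_line_const_of_ae_mem_countable (f := fun y => Q ⟨x, y⟩) (L := K)
        (LipschitzWith.of_dist_le_mul fun y y' => ?_) hA hx y
      refine (hQ.dist_le_mul _ _).trans (le_of_eq ?_)
      rw [Complex.dist_of_re_eq (z := ⟨x, y⟩) (w := ⟨x, y'⟩) rfl]
    -- Fubini gives constancy only on almost every vertical line. The good abscissae are dense and
    -- form a closed set, so every line is good.
    have hcl : IsClosed {x : ℝ | ∀ y : ℝ, Q ⟨x, y⟩ = Q ⟨x, 0⟩} := by
      simp only [Set.ofPred_forall]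
      refine isClosed_iInter fun y => isClosed_eq ?_ ?_ <;>
      · refine hQ.continuous.comp ?_
        exact Complex.equivRealProdCLM.symm.continuous.comp (by fun_prop : Continuous fun x : ℝ =>
          (x, (_ : ℝ)))
    intro x
    have := (Measure.dense_of_ae h2).closure_eq
    rw [hcl.closure_eq] at this
    have hx : x ∈ {x : ℝ | ∀ y : ℝ, Q ⟨x, y⟩ = Q ⟨x, 0⟩} := this.symm ▸ Set.mem_univ x
    exact hx
  have hhor : ∀ x y : ℝ, Q ⟨x, y⟩ = Q ⟨0, y⟩ := by
    have hsw : ∀ᵐ p : ℝ × ℝ, Q ⟨p.2, p.1⟩ ∈ A :=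
      (Measure.measurePreserving_swap (μ := (volume : Measure ℝ))
        (ν := (volume : Measure ℝ))).quasiMeasurePreserving.ae hprod
    have h1 : ∀ᵐ y : ℝ, ∀ᵐ x : ℝ, Q ⟨x, y⟩ ∈ A := Measure.ae_ae_of_ae_prod hsw
    have h2 : ∀ᵐ y : ℝ, ∀ x : ℝ, Q ⟨x, y⟩ = Q ⟨0, y⟩ := by
      filter_upwards [h1] with y hy x
      refine lipschitz_line_const_of_ae_mem_countable (f := fun x => Q ⟨x, y⟩) (L := K)
        (LipschitzWith.of_dist_le_mul fun x x' => ?_) hA hy x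
      refine (hQ.dist_le_mul _ _).trans (le_of_eq ?_)
      rw [Complex.dist_of_im_eq (z := ⟨x, y⟩) (w := ⟨x', y⟩) rfl]
    have hcl : IsClosed {y : ℝ | ∀ x : ℝ, Q ⟨x, y⟩ = Q ⟨0, y⟩} := by
      simp only [Set.ofPred_forall]
      refine isClosed_iInter fun x => isClosed_eq ?_ ?_ <;>
      · refine hQ.continuous.comp ?_
        exact Complex.equivRealProdCLM.symm.continuous.comp (by fun_prop : Continuous fun y : ℝ =>
          ((_ : ℝ), y))
    intro x y
    have := (Measure.dense_of_ae h2).closure_eq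
    rw [hcl.closure_eq] at this
    have hy : y ∈ {y : ℝ | ∀ x : ℝ, Q ⟨x, y⟩ = Q ⟨0, y⟩} := this.symm ▸ Set.mem_univ y
    exact hy x
  calc Q u = Q ⟨u.re, u.im⟩ := rfl
    _ = Q ⟨u.re, 0⟩ := hvert _ _
    _ = Q ⟨0, 0⟩ := hhor _ _
    _ = Q 0 := rfl

/-- The mutual information of a random variable and a deterministic function of it is infinite
unless the function takes almost all its values in a countable set. -/
lemma exists_countable_of_mutualInfo_ne_top {Ω α β : Type*} [MeasurableSpace Ω]
    [MeasurableSpace α] [MeasurableSpace β] [MeasurableSingletonClass β]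
    [MeasurableEq β] {μ : Measure Ω}
    [IsProbabilityMeasure μ] {X : Ω → α} (hX : AEMeasurable X μ) {f : α → β} (hf : Measurable f)
    (h : mutualInfo μ X (fun ω => f (X ω)) ≠ ∞) :
    ∃ A : Set β, A.Countable ∧ ∀ᵐ x ∂(μ.map X), f x ∈ A := by
  have hY : AEMeasurable (fun ω => f (X ω)) μ := hf.comp_aemeasurable hX
  have := Measure.isProbabilityMeasure_map hX
  have := Measure.isProbabilityMeasure_map hY
  have hac := (InformationTheory.klDiv_ne_top_iff.mp h).1
  set q := μ.map fun ω => f (X ω) with hq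
  have hA : {y | 0 < q {y}}.Countable :=
    Measure.countable_meas_pos_of_disjoint_iUnion (μ := q) (As := fun y : β => {y})
      (fun y => measurableSet_singleton y) fun x y hxy => by simpa using hxy
  refine ⟨{y | 0 < q {y}}, hA, ?_⟩
  -- S is the graph of f over the values that are not atoms of the output law. Each vertical section
  -- is empty or a null singleton, so S is null for the product law and, by absolute continuity, for
  -- the joint law, which lives on the graph.
  set S : Set (α × β) := {p | p.2 = f p.1} ∩ {p | p.2 ∉ {y | 0 < q {y}}} with hS
  have hSm : MeasurableSet S :=
    (measurableSet_eq_fun measurable_snd (hf.comp measurable_fst)).inter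
      (measurable_snd hA.measurableSet.compl)
  have h0 : ((μ.map X).prod q) S = 0 := by
    rw [Measure.prod_apply hSm, lintegral_eq_zero_iff' (measurable_measure_prodMk_left hSm).aemeasurable]
    refine ae_of_all _ fun x => ?_
    by_cases hx : 0 < q {f x}
    · have : Prod.mk x ⁻¹' S = ∅ := by
        ext y
        simp only [hS, Set.mem_preimage, Set.mem_inter_iff, Set.mem_ofPred_eq, Set.mem_empty_iff_false,
          iff_false, not_and, not_not]
        rintro rfl
        exact hx
      simp [this]
    · refine measure_mono_null (t := {f x}) (fun y hy => hy.1) ?_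
      simpa using hx
  have h1 := hac h0
  rw [Measure.map_apply_of_aemeasurable (hX.prodMk hY) hSm] at h1
  rw [ae_map_iff hX (hf hA.measurableSet)]
  rw [ae_iff]
  refine measure_mono_null (fun ω hω => ?_) h1
  exact ⟨rfl, hω⟩

/-- Fubini: almost every choice of the other coordinates leaves the property true for almost every
value of coordinate k. -/
lemma exists_ae_update_of_ae_pi {N : ℕ} {ν : Fin N → Measure ℂ} [∀ k, IsProbabilityMeasure (ν k)]
    {p : (Fin N → ℂ) → Prop} (h : ∀ᵐ x ∂(Measure.pi ν), p x) (k : Fin N) :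
    ∃ x : Fin N → ℂ, ∀ᵐ t ∂(ν k), p (Function.update x k t) := by
  obtain ⟨n, rfl⟩ : ∃ n, N = n + 1 := ⟨N - 1, by have := k.pos; omega⟩
  have h1 := (measurePreserving_piFinSuccAbove ν k).symm.quasiMeasurePreserving.ae h
  have h2 := (Measure.measurePreserving_swap
    (μ := Measure.pi fun j => ν (k.succAbove j)) (ν := ν k)).quasiMeasurePreserving.ae h1
  obtain ⟨y, hy⟩ := (Measure.ae_ae_of_ae_prod h2).exists
  refine ⟨k.insertNth (0 : ℂ) y, hy.mono fun t ht => ?_⟩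
  have : Function.update (k.insertNth (0 : ℂ) y : Fin (n + 1) → ℂ) k t = k.insertNth t y := by
    simp
  rw [this]
  exact ht

/-- For a fixed transform and a nonconstant converter, the noiseless channel has infinite mutual
information. -/
theorem mutualInfo_conjTransform_eq_top {Ω : Type*} [MeasurableSpace Ω] {μ : Measure Ω}
    [IsProbabilityMeasure μ] {N : ℕ} {P : Fin N → ℝ} {k : Fin N} (hk : 0 < P k)
    {z : Ω → Fin N → ℂ} (hz : HasLaw z (Measure.pi fun k => complexGaussian (P k)) μ)
    {Q : ℂ → ℂ} {K : ℝ≥0} (hQ : LipschitzWith K Q) (hne : ∃ u, Q u ≠ Q 0)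
    (V : Matrix.unitaryGroup (Fin N) ℂ) :
    mutualInfo μ z (fun ω => conjTransform (fun w n => Q (w n)) (z ω) V) = ∞ := by
  by_contra htop
  have hfm : Measurable fun x : Fin N → ℂ => conjTransform (fun w n => Q (w n)) x V := by
    have hc : Continuous fun x : Fin N → ℂ => conjTransform (fun w n => Q (w n)) x V :=
      (continuous_conjTransform_prod (continuous_componentwise hQ)).comp
        (Continuous.prodMk_right V)
    exact hc.measurable
  obtain ⟨A, hA, hmem⟩ := exists_countable_of_mutualInfo_ne_top hz.aemeasurable hfm htop
  rw [hz.map_eq] at hmem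
  obtain ⟨x, hx⟩ := exists_ae_update_of_ae_pi hmem k
  -- Column k of Vᴴ is nonzero by unitarity, so some time-domain sample really depends on symbol k.
  obtain ⟨n, hn⟩ : ∃ n, (V : Matrix (Fin N) (Fin N) ℂ)ᴴ n k ≠ 0 := by
    by_contra! h
    have h1 := mulVec_conjTranspose_mulVec V (Pi.single k 1)
    have h2 : (V : Matrix (Fin N) (Fin N) ℂ)ᴴ *ᵥ Pi.single k 1 = 0 := by
      ext n
      simpa using h n
    rw [h2, Matrix.mulVec_zero] at h1
    have := congrFun h1 k
    simp at this
  set c := (V : Matrix (Fin N) (Fin N) ℂ)ᴴ n k with hc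
  set b := ((V : Matrix (Fin N) (Fin N) ℂ)ᴴ *ᵥ Function.update x k 0) n with hb
  have hlin : ∀ t : ℂ, ((V : Matrix (Fin N) (Fin N) ℂ)ᴴ *ᵥ Function.update x k t) n =
      c * t + b := by
    intro t
    have h1 : Function.update x k t = Pi.single k t + Function.update x k 0 := by
      ext j
      by_cases hj : j = k
      · subst hj
        simp
      · simp [hj]
    rw [h1, Matrix.mulVec_add, Pi.add_apply, Matrix.mulVec_single]
    simp [hc, hb, mul_comm]
  -- Undoing V on the output and reading sample n gives Q(ct + b), which thus takes values in a
  -- countable set for almost all t.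
  have hA' := hA.image fun y => ((V : Matrix (Fin N) (Fin N) ℂ)ᴴ *ᵥ y) n
  have hae : ∀ᵐ t ∂(complexGaussian (P k)), Q (c * t + b) ∈
      (fun y => ((V : Matrix (Fin N) (Fin N) ℂ)ᴴ *ᵥ y) n) '' A := by
    filter_upwards [hx] with t ht
    refine ⟨_, ht, ?_⟩
    simp only [conjTransform]
    rw [conjTranspose_mulVec_mulVec, hlin]
  have hvol := (volume_absolutelyContinuous_complexGaussian hk).ae_le hae
  have hL : LipschitzWith (K * ‖c‖₊) fun t => Q (c * t + b) := by
    refine hQ.comp (LipschitzWith.of_dist_le_mul fun t t' => ?_)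
    rw [dist_add_right, dist_eq_norm, ← mul_sub, norm_mul, dist_eq_norm, coe_nnnorm]
  have hconst := lipschitz_const_of_ae_mem_countable hL hA' hvol
  obtain ⟨u, hu⟩ := hne
  apply hu
  -- As c ≠ 0, the affine map t ↦ ct + b is onto; constancy is evaluated at the preimages of u and
  -- of 0.
  have h1 := hconst ((u - b) / c)
  have h2 := hconst ((0 - b) / c)
  rw [mul_div_cancel₀ _ hn, sub_add_cancel] at h1 h2
  rw [h1, h2]

/-! ### Constant converters and the divergence form of the bound -/

lemma integral_conj_complexGaussian (v : ℝ) : ∫ u, conj u ∂(complexGaussian v) = 0 := by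
  have h1 : Integrable (fun u : ℂ => u) (complexGaussian v) :=
    memLp_one_iff_integrable.mp (by simpa using memLp_id_complexGaussian v 1)
  have h2 : ∫ u, u ∂(complexGaussian v) = 0 := by
    have hre : ∫ u : ℂ, u.re ∂(complexGaussian v) = 0 := by
      rw [integral_complexGaussian]
      simp [integral_fun_fst (fun x : ℝ => x), integral_id_gaussianReal]
    have him : ∫ u : ℂ, u.im ∂(complexGaussian v) = 0 := by
      rw [integral_complexGaussian]
      simp [integral_fun_snd (fun x : ℝ => x), integral_id_gaussianReal]
    rw [← integral_re_add_im h1]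
    simp [hre, him]
  rw [integral_conj, h2, map_zero]

lemma alphaTx_eq_zero_of_const {Q : ℂ → ℂ} (hQ : ∀ u, Q u = Q 0) (v : ℝ) : alphaTx Q v = 0 := by
  have h : (fun u => conj u * Q u) = fun u => conj u * Q 0 := funext fun u => by rw [hQ u]
  rw [alphaTx, h, integral_mul_const, integral_conj_complexGaussian, zero_mul, zero_div]

lemma sum_fractions_eq_one {M : ℕ} {a : ∀ N : ℕ, Fin N → Fin M} {δ : Fin M → ℝ}
    (hδ : ∀ m, Tendsto (fun N : ℕ => (Nat.card {k : Fin N // a N k = m} : ℝ) / (N : ℝ))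
      atTop (𝓝 (δ m))) : ∑ m, δ m = 1 := by
  have h := tendsto_sum_comp_div hδ fun _ => (1 : ℝ)
  have h1 : Tendsto (fun N : ℕ => (∑ _k : Fin N, (1 : ℝ)) / (N : ℝ)) atTop (𝓝 1) := by
    refine tendsto_const_nhds.congr' ?_
    filter_upwards [eventually_gt_atTop 0] with N hN
    have : (N : ℝ) ≠ 0 := by exact_mod_cast hN.ne'
    simp [this]
  simpa using tendsto_nhds_unique h h1

/-- The sub-band form of the rate bound equals its divergence form. -/
lemma sum_log_one_add_eq_log_sub_vecDivergence {M : ℕ} {δ P : Fin M → ℝ} (hδ : ∑ m, δ m = 1)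
    (hP : ∀ m, 0 ≤ P m) {Pbar τ : ℝ} (hPbar : 0 < Pbar) (hτ : 0 < τ) (α : ℂ) :
    ∑ m, δ m * Real.log (1 + ‖α‖ ^ 2 * P m / (τ * Pbar)) =
      Real.log (1 + ‖α‖ ^ 2 / τ) - vecDivergence δ (energyFraction δ P Pbar α τ) := by
  have hlog : Real.log (1 + ‖α‖ ^ 2 / τ) = ∑ m, δ m * Real.log (1 + ‖α‖ ^ 2 / τ) := by
    rw [← Finset.sum_mul, hδ, one_mul]
  rw [hlog, vecDivergence, ← Finset.sum_sub_distrib]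
  refine Finset.sum_congr rfl fun m _ => ?_
  rcases eq_or_ne (δ m) 0 with h0 | h0
  · simp [h0]
  have hPm := hP m
  rw [← mul_sub, ← Real.log_div (by positivity) ?_]
  · congr 2
    rw [energyFraction]
    field_simp
    ring
  · have : 0 < ‖α‖ ^ 2 * P m / Pbar + τ := by positivity
    have h2 : 0 < ‖α‖ ^ 2 + τ := by positivity
    rw [energyFraction]
    exact div_ne_zero h0 (div_ne_zero (mul_ne_zero h0 this.ne') h2.ne')

/-- The linear rate of fixed transforms at zero noise. -/
theorem le_asymptoticRate_fixed
    {Ω : Type*} [MeasurableSpace Ω] (μ : Measure Ω) [IsProbabilityMeasure μ]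
    {M : ℕ} (a : ∀ N : ℕ, Fin N → Fin M) (δ : Fin M → ℝ)
    (hδ : ∀ m, Tendsto (fun N : ℕ => (Nat.card {k : Fin N // a N k = m} : ℝ) / (N : ℝ))
      atTop (𝓝 (δ m)))
    (P : Fin M → ℝ) (v : ℝ) (hv : v = ∑ m, δ m * P m) (hv0 : 0 < v)
    (Q : ℂ → ℂ) (K : ℝ≥0) (hQ : LipschitzWith K Q) (s : ℝ)
    (V : ∀ N : ℕ, Matrix.unitaryGroup (Fin N) ℂ) (z : ∀ N : ℕ, Ω → Fin N → ℂ)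
    (hz : ∀ N, HasLaw (z N) (Measure.pi fun k => complexGaussian (P (a N k))) μ) :
    ((∑ m, δ m * Real.log (1 + ‖alphaTx Q v‖ ^ 2 * P m / s) : ℝ) : EReal) ≤
      (asymptoticRate fun N => mutualInfo μ (z N) fun ω =>
        conjTransform (fun w n => Q (w n)) (z N ω) (V N) : ℝ≥0∞) := by
  by_cases hne : ∃ u, Q u ≠ Q 0
  · refine le_asymptoticRate fun ε _ => ?_
    have hPlim := tendsto_sum_comp_div hδ P
    rw [← hv] at hPlim
    filter_upwards [hPlim.eventually_const_lt hv0] with N hN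
    -- Positive limiting average power eventually guarantees an active symbol, which is all that
    -- infinite mutual information requires.
    have hpos : 0 < ∑ k, P (a N k) := by
      by_contra hle
      exact absurd (div_nonpos_of_nonpos_of_nonneg (not_lt.mp hle) (Nat.cast_nonneg N)) hN.not_ge
    obtain ⟨k, -, hk⟩ := Finset.exists_lt_of_sum_lt
      (f := fun _ => (0 : ℝ)) (by simpa using hpos)
    rw [mutualInfo_conjTransform_eq_top (P := fun k => P (a N k)) hk (hz N) hQ hne]
    exact le_top
  · push Not at hne
    have : ∑ m, δ m * Real.log (1 + ‖alphaTx Q v‖ ^ 2 * P m / s) = 0 := by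
      simp [alphaTx_eq_zero_of_const hne]
    rw [this, EReal.coe_zero]
    exact EReal.coe_ennreal_nonneg _

/-! ### The rate bound -/

theorem theorem3
    {Ω : Type*} [MeasurableSpace Ω] (μ : Measure Ω) [IsProbabilityMeasure μ]
    -- number of sub-bands, sub-band selection vectors, bandwidth fractions
    {M : ℕ} (a : ∀ N : ℕ, Fin N → Fin M) (δ : Fin M → ℝ)
    (hδ : ∀ m, Tendsto (fun N : ℕ => (Nat.card {k : Fin N // a N k = m} : ℝ) / (N : ℝ))
      atTop (𝓝 (δ m)))
    -- symbol energies and the average energy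
    (P : Fin M → ℝ) (hP : ∀ m, 0 ≤ P m)
    (Pbar : ℝ) (hPbar : Pbar = ∑ m, δ m * P m) (hPbar_pos : 0 < Pbar)
    -- the DAC
    (Qtx : ℂ → ℂ) (K : ℝ≥0) (hQ : LipschitzWith K Qtx)
    -- its gain and distortion
    (α : ℂ) (hα : α = alphaTx Qtx Pbar) (τ : ℝ) (hτ : τ = tauTx Qtx Pbar) (hτ_pos : 0 < τ)
    -- random unitary transforms, symbols and noise of zero variance
    (V : ∀ N : ℕ, Ω → Matrix.unitaryGroup (Fin N) ℂ) (z ξ : ∀ N : ℕ, Ω → Fin N → ℂ)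
    (hV : ∀ N, HasLaw (V N) (haarUnitary N) μ)
    (hz : ∀ N, HasLaw (z N) (Measure.pi fun k => complexGaussian (P (a N k))) μ)
    (hξ : ∀ N, HasLaw (ξ N) (Measure.pi fun _ => complexGaussian 0) μ)
    (hVzξ : ∀ N, IndepFun (V N) (fun ω => (z N ω, ξ N ω)) μ)
    (hzξ : ∀ N, IndepFun (z N) (ξ N) μ) :
    -- the linear rate of the ensemble, the transform being part of the randomness
    ((Real.log (1 + ‖α‖ ^ 2 / τ) - vecDivergence δ (energyFraction δ P Pbar α τ) : ℝ) : EReal) ≤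
        (asymptoticRate fun N => mutualInfo μ (z N) fun ω =>
          receivedSymbols Qtx (fun x w => x + w) id (V N ω) (z N ω) (ξ N ω) : ℝ≥0∞) ∧
    -- the linear rate of almost every realization of the transforms
    (∀ᵐ ω₀ ∂μ,
      ((Real.log (1 + ‖α‖ ^ 2 / τ) - vecDivergence δ (energyFraction δ P Pbar α τ) : ℝ) : EReal) ≤
        (asymptoticRate fun N => mutualInfo μ (z N) fun ω =>
          receivedSymbols Qtx (fun x w => x + w) id (V N ω₀) (z N ω) (ξ N ω) : ℝ≥0∞)) ∧
    -- the right-hand side is the rate bound of the AWGN channel at zero noise variance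
    ∑ m, δ m * Real.log (1 + ‖α‖ ^ 2 * P m / (τ * Pbar)) =
      Real.log (1 + ‖α‖ ^ 2 / τ) - vecDivergence δ (energyFraction δ P Pbar α τ) := by
  have hbound := sum_log_one_add_eq_log_sub_vecDivergence (sum_fractions_eq_one hδ) hP hPbar_pos
    hτ_pos α
  have hs : 0 < τ * Pbar := mul_pos hτ_pos hPbar_pos
  -- The test channel uses the unnormalized distortion variance s = τP̄, matching the denominators
  -- in the sub-band form.
  have hsQ : τ * Pbar = ∫ u, ‖Qtx u - alphaTx Qtx Pbar * u‖ ^ 2 ∂(complexGaussian Pbar) := by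
    rw [hτ, tauTx, div_mul_cancel₀ _ hPbar_pos.ne']
  have hVz : ∀ N, HasLaw (fun ω => (V N ω, z N ω))
      ((haarUnitary N).prod (Measure.pi fun k => complexGaussian (P (a N k)))) μ := fun N =>
    IndepFun.hasLaw_prod (hV N) (hz N) ((hVzξ N).comp measurable_id measurable_fst)
  rw [← hbound, hα]
  -- The fixed-transform bound holds for every sequence of unitary matrices, so no exceptional null
  -- set is needed.
  refine ⟨?_, ae_of_all _ fun ω₀ => ?_, rfl⟩
  · refine (le_asymptoticRate_ensemble μ a δ hδ P hP Pbar hPbar hPbar_pos Qtx K hQ (τ * Pbar) hs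
      hsQ V z hVz).trans (le_of_eq ?_)
    congr 2
    funext N
    refine mutualInfo_congr_right ?_
    filter_upwards [ae_eq_zero_of_hasLaw_complexGaussian_zero (hξ N)] with ω hω
    rw [hω, receivedSymbols_zero_noise]
  · refine (le_asymptoticRate_fixed μ a δ hδ P Pbar hPbar hPbar_pos Qtx K hQ (τ * Pbar)
      (fun N => V N ω₀) z hz).trans (le_of_eq ?_)
    congr 2
    funext N
    refine mutualInfo_congr_right ?_
    filter_upwards [ae_eq_zero_of_hasLaw_complexGaussian_zero (hξ N)] with ω hω
    rw [hω, receivedSymbols_zero_noise]
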